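/- Let $n\ge 1$, let $A,C\in\mathbb R^{n\times n}$, $B,D\in\mathbb R^{n\times m_1}$, $G\in\mathbb R^{n\times m_2}$, let $Q\in\mathbb R^{n\times n}$ be symmetric with $Q\ge 0$, let $R\in\mathbb R^{m_1\times m_1}$ be symmetric with $R>0$, and let $\gamma>0$. For $K\in\mathbb R^{m_1\times n}$ and $L\in\mathbb R^{m_2\times n}$ define the operator on symmetric matrices $$\mathscr L_{[K,L]}(P)=(A-BK+GL)^\top P+P(A-BK+GL)+(C-DK)^\top P(C-DK),$$ let $\sigma(\mathscr L_{[K,L]})\subset\mathbb C$ be its spectrum, and put $\mathscr K^1(P)=(R+D^\top PD)^{-1}(B^\top P+D^\top PC)$ and $\mathscr K^2(P)=\gamma^{-2}G^\top P$. Assume that $[A,B|C,D]$ is stabilizable (for some $K$ every solution of $dx=(A-BK)x\,dt+(C-DK)x\,dw$ satisfies $\mathbb E|x(t)|^2\to0$) and that $[A,Q|C]$ is exactly detectable (every solution of $dx=Ax\,dt+Cx\,dw$, $x(0)=x_0$, with $Qx(t)=0$ almost surely for all $t\ge0$ satisfies $\mathbb E|x(t)|^2\to0$). Let $P^*\ge0$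 be the stabilizing solution of $$A^\top P+PA+C^\top PC+Q+\tfrac1{\gamma^2}PGG^\top P-(PB+C^\top PD)(R+D^\top PD)^{-1}(B^\top P+D^\top PC)=0,$$ that is, the solution for which $\sigma(\mathscr L_{[\mathscr K^1(P^*),\mathscr K^2(P^*)]})$ lies in the open left half-plane $\mathbb C^-$. For a sequence $\delta L_p=\{\delta L_p^k\}_{k\ge1}$ in $\mathbb R^{m_2\times n}$, the inexact outer-loop iteration is the following: $\hat L_p^0=0$; for $k\ge 0$, $\hat P^{k+1}$ is the stabilizing solution of $$\mathscr L_{[K_p^{k+1},\hat L_p^{k}]}(\hat P^{k+1})+Q-\gamma^2(\hat L_p^{k})^\top\hat L_p^{k}+(K_p^{k+1})^\top RK_p^{k+1}=0,\qquad K_p^{k+1}=\mathscr K^1(\hat P^{k+1}),$$ i.e. the symmetric solution with $R+D^\top\hat P^{k+1}D>0$ and $\sigma(\mathscr L_{[K_p^{k+1},\hat L_p^{k}]})\subset\mathbb C^-$; and $\hat L_p^k=\mathscr K^2(\hat P^k)+\delta L_p^k$ for $k\ge1$. Write $\|\delta L_p\|_\infty=\sup_{k\ge1}\|\delta L_p^k\|_F$.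 Then for every $\zeta\ge\mathrm{Tr}(P^*)$ there are $\varepsilon>0$, a class-$\mathcal{KL}$ function $\ell$ and a class-$\mathcal K$ function $\kappa$, of the form $\ell(r,k)=\alpha^k\sqrt n\,r$ and $\kappa(s)=c\,s^2$ with constants $\alpha\in(0,1)$ and $c>0$, such that for every disturbance sequence with $\|\delta L_p\|_\infty<\varepsilon$ the inexact iteration is well defined (the sequences $\{\hat P^{k}\}_{k\ge1}$ and $\{\hat L_p^k\}_{k\ge0}$ exist and are unique) and, for all $k\ge1$, $$\|P^*-\hat P^{k+1}\|_F\le\ell\big(\|P^*-\hat P^1\|_F,k\big)+\kappa\big(\|\delta L_p\|_\infty\big).$$ -/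

import Mathlib

open Matrix Filter Topology

attribute [local instance] Matrix.frobeniusNormedAddCommGroup

/-- The data of the problem: the dynamics
`dx = (A x + B u + G v) dt + (C x + D u) dw` with state in `ℝⁿ`, control in `ℝ^{m₁}` and
disturbance in `ℝ^{m₂}`, the weights `Q`, `R` of the cost and the attenuation level `γ`. -/
structure RobustLQ (n m₁ m₂ : ℕ) where
  A : Matrix (Fin n) (Fin n) ℝ
  B : Matrix (Fin n) (Fin m₁) ℝ
  G : Matrix (Fin n) (Fin m₂) ℝ
  C : Matrix (Fin n) (Fin n) ℝ
  D : Matrix (Fin n) (Fin m₁) ℝ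
  Q : Matrix (Fin n) (Fin n) ℝ
  R : Matrix (Fin m₁) (Fin m₁) ℝ
  γ : ℝ

/-- The generalized Lyapunov expression `Fᵀ P + P F + Hᵀ P H`. -/
def genLyap {n : ℕ} {𝕜 : Type*} [CommRing 𝕜] (F H P : Matrix (Fin n) (Fin n) 𝕜) :
    Matrix (Fin n) (Fin n) 𝕜 :=
  Fᵀ * P + P * F + Hᵀ * P * H

/-- The spectrum of `P ↦ Fᵀ P + P F + Hᵀ P H` as an operator on symmetric matrices. As the
eigenvalues are complex, the eigenvectors range over the complexification of the space of real
symmetric matrices, that is, over the complex matrices with `Pᵀ = P`. -/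
def lyapSpectrum {n : ℕ} (F H : Matrix (Fin n) (Fin n) ℝ) : Set ℂ :=
  {μ : ℂ | ∃ P : Matrix (Fin n) (Fin n) ℂ, P.IsSymm ∧ P ≠ 0 ∧
    genLyap (F.map Complex.ofReal) (H.map Complex.ofReal) P = μ • P}

/-- `X` is the second moment `t ↦ E[x(t) x(t)ᵀ]`, `t ≥ 0`, of the solution of the linear Itô equation
`dx = F x dt + H x dw`, `x(0) = x₀`: the unique solution of
`X' = F X + X Fᵀ + H X Hᵀ`, `X(0) = x₀ x₀ᵀ`. -/
def IsSecondMoment {n : ℕ} (F H : Matrix (Fin n) (Fin n) ℝ) (x₀ : Fin n → ℝ)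
    (X : ℝ → Matrix (Fin n) (Fin n) ℝ) : Prop :=
  X 0 = vecMulVec x₀ x₀ ∧
    ∀ t : ℝ, 0 ≤ t → ∀ i j : Fin n,
      HasDerivWithinAt (fun s => X s i j) ((F * X t + X t * Fᵀ + H * X t * Hᵀ) i j) (Set.Ici 0) t

namespace RobustLQ

variable {n m₁ m₂ : ℕ}

/-- The closed-loop drift `A - B K + G L`. -/
def drift (S : RobustLQ n m₁ m₂) (K : Matrix (Fin m₁) (Fin n) ℝ) (L : Matrix (Fin m₂) (Fin n) ℝ) :
    Matrix (Fin n) (Fin n) ℝ :=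
  S.A - S.B * K + S.G * L

/-- The closed-loop diffusion `C - D K`. -/
def diffusion (S : RobustLQ n m₁ m₂) (K : Matrix (Fin m₁) (Fin n) ℝ) :
    Matrix (Fin n) (Fin n) ℝ :=
  S.C - S.D * K

/-- The generalized Lyapunov operator
`P ↦ (A - B K + G L)ᵀ P + P (A - B K + G L) + (C - D K)ᵀ P (C - D K)`. -/
def lyapOp (S : RobustLQ n m₁ m₂) (K : Matrix (Fin m₁) (Fin n) ℝ) (L : Matrix (Fin m₂) (Fin n) ℝ)
    (P : Matrix (Fin n) (Fin n) ℝ) : Matrix (Fin n) (Fin n) ℝ :=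
  genLyap (S.drift K L) (S.diffusion K) P

/-- The spectrum of `S.lyapOp K L` lies in the open left half-plane. -/
def SpectrallyStable (S : RobustLQ n m₁ m₂) (K : Matrix (Fin m₁) (Fin n) ℝ)
    (L : Matrix (Fin m₂) (Fin n) ℝ) : Prop :=
  lyapSpectrum (S.drift K L) (S.diffusion K) ⊆ {μ : ℂ | μ.re < 0}

/-- `[A, B | C, D]` is stabilizable: some feedback `u = -K x` makes
`dx = (A - B K) x dt + (C - D K) x dw` asymptotically mean square stable, i.e.
`E|x(t)|² = tr E[x(t) x(t)ᵀ] → 0` for every initial state. -/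
def Stabilizable (S : RobustLQ n m₁ m₂) : Prop :=
  ∃ K : Matrix (Fin m₁) (Fin n) ℝ, ∀ (x₀ : Fin n → ℝ) (X : ℝ → Matrix (Fin n) (Fin n) ℝ),
    IsSecondMoment (S.A - S.B * K) (S.C - S.D * K) x₀ X →
      Tendsto (fun t => (X t).trace) atTop (𝓝 0)

/-- `[A, Q | C]` is exactly detectable: if the output `y = Q x` of `dx = A x dt + C x dw` vanishes
almost surely at all times, i.e. `E|y(t)|² = tr (Q E[x(t) x(t)ᵀ] Qᵀ) = 0` for all `t ≥ 0`, then
`E|x(t)|² → 0`. -/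
def ExactlyDetectable (S : RobustLQ n m₁ m₂) : Prop :=
  ∀ (x₀ : Fin n → ℝ) (X : ℝ → Matrix (Fin n) (Fin n) ℝ), IsSecondMoment S.A S.C x₀ X →
    (∀ t : ℝ, 0 ≤ t → (S.Q * X t * S.Qᵀ).trace = 0) →
      Tendsto (fun t => (X t).trace) atTop (𝓝 0)

/-- The control gain `(R + Dᵀ P D)⁻¹ (Bᵀ P + Dᵀ P C)`. -/
noncomputable def gainK (S : RobustLQ n m₁ m₂) (P : Matrix (Fin n) (Fin n) ℝ) :
    Matrix (Fin m₁) (Fin n) ℝ :=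
  (S.R + S.Dᵀ * P * S.D)⁻¹ * (S.Bᵀ * P + S.Dᵀ * P * S.C)

/-- The disturbance gain `γ⁻² Gᵀ P`. -/
noncomputable def gainL (S : RobustLQ n m₁ m₂) (P : Matrix (Fin n) (Fin n) ℝ) :
    Matrix (Fin m₂) (Fin n) ℝ :=
  (1 / S.γ ^ 2) • (S.Gᵀ * P)

/-- `P ≥ 0` is a stabilizing solution of the indefinite stochastic algebraic Riccati equation: it
solves the equation and the closed loop with both gains of `P` is stable. (For `R > 0` and `P ≥ 0`
the matrix `R + Dᵀ P D` is invertible, and such a `P` is unique.) -/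
def IsStabilizingSARE (S : RobustLQ n m₁ m₂) (P : Matrix (Fin n) (Fin n) ℝ) : Prop :=
  P.PosSemidef ∧
    S.Aᵀ * P + P * S.A + S.Cᵀ * P * S.C + S.Q + (1 / S.γ ^ 2) • (P * S.G * S.Gᵀ * P)
      - (P * S.B + S.Cᵀ * P * S.D) * (S.R + S.Dᵀ * P * S.D)⁻¹ * (S.Bᵀ * P + S.Dᵀ * P * S.C) = 0 ∧
    S.SpectrallyStable (S.gainK P) (S.gainL P)

/-- `P` is a symmetric stabilizing solution, with `R + Dᵀ P D > 0`, of the `H₂`-type equation in which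
the disturbance gain `L` is fixed and the control gain is `gainK P`. -/
def IsOuterSolution (S : RobustLQ n m₁ m₂) (L : Matrix (Fin m₂) (Fin n) ℝ)
    (P : Matrix (Fin n) (Fin n) ℝ) : Prop :=
  P.IsSymm ∧ (S.R + S.Dᵀ * P * S.D).PosDef ∧
    S.lyapOp (S.gainK P) L P + (S.Q - S.γ ^ 2 • (Lᵀ * L)) + (S.gainK P)ᵀ * S.R * S.gainK P = 0 ∧
    S.SpectrallyStable (S.gainK P) L

/-- `P 1, P 2, …` and `L 0, L 1, …` are generated by the inexact outer loop with disturbances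
`δL 1, δL 2, …`: `L 0 = 0`, `P (k + 1)` solves the equation with the gain `L k`, and
`L k = gainL (P k) + δL k` for `k ≥ 1`. The values `P 0` and `δL 0` are not used. -/
def IsInexactOuterLoop (S : RobustLQ n m₁ m₂) (δL : ℕ → Matrix (Fin m₂) (Fin n) ℝ)
    (P : ℕ → Matrix (Fin n) (Fin n) ℝ) (L : ℕ → Matrix (Fin m₂) (Fin n) ℝ) : Prop :=
  L 0 = 0 ∧ (∀ k, S.IsOuterSolution (L k) (P (k + 1))) ∧
    ∀ k, 1 ≤ k → L k = S.gainL (P k) + δL k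

end RobustLQ

/-- `sup_{k ≥ 1} ‖δ k‖_F`, meaningful for bounded sequences. -/
noncomputable def supFrob {m n : ℕ} (δ : ℕ → Matrix (Fin m) (Fin n) ℝ) : ℝ :=
  ⨆ k : ℕ, ‖δ (k + 1)‖

/-- Class `K` functions on `[0, ∞)`. -/
def IsClassK (κ : ℝ → ℝ) : Prop :=
  κ 0 = 0 ∧ ContinuousOn κ (Set.Ici 0) ∧ StrictMonoOn κ (Set.Ici 0)

/-- Class `KL` functions on `[0, ∞) × [0, ∞)`. -/
def IsClassKL (ℓ : ℝ → ℝ → ℝ) : Prop :=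
  ContinuousOn (fun p : ℝ × ℝ => ℓ p.1 p.2) (Set.Ici 0 ×ˢ Set.Ici 0) ∧
    (∀ t, 0 ≤ t → IsClassK fun r => ℓ r t) ∧
    ∀ r, 0 ≤ r → AntitoneOn (ℓ r) (Set.Ici 0) ∧ Tendsto (ℓ r) atTop (𝓝 0)

/-! Stability is expressed by a quadratic Lyapunov function (`MSStable`), and
`lyapSpectrum_subset_iff` identifies this with the spectral condition. The engine is resolvent
positivity, `MSStable.posSemidef`: a Lyapunov operator can only increase the quadratic form at a
null vector of a positive semidefinite matrix. It yields the Perron–Frobenius type dichotomy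
`msStable_or_exists_eigenvector`. Applied to the adjoint operator, the dichotomy gives every
unstable loop a non-decaying second moment `X ≥ 0`. Detectability is tested against that `X`.

Without disturbances the loop starts at `0` and increases. Completing squares in both gains shows
that each iterate is a subsolution, and `Pstar` a supersolution, of the next equation. A
supersolution of minimal trace in between is the next iterate (`exists_isOuterSolution`). The limit
solves the same Riccati equation as `Pstar`, but its closed loop is only known to be a limit of
stable ones. It still equals `Pstar`: the difference of two solutions is killed by the mixed
Lyapunov operator of their loops, which is injective because one loop has a stability margin and the
other an arbitrarily small growth rate (`tendsto_exact_iteration`).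

Near `Pstar` the error of a step is quadratic in the error of the disturbance gain
(`exists_quadratic_estimate`), as for Newton's method. A small ball is therefore invariant under
small disturbances, and each step contracts by `1/2` up to `C‖δ‖²` (`exists_local_contraction`).

The two regimes are joined in `exists_inexact_estimate`. Since `L 0 = 0`, the first iterate does not
see the disturbance, so a single exact trajectory has to be followed. It enters the small ball after
some number `N` of steps. Until then its error is strictly below the first error, so one `α < 1`
near `1` fits all these steps, and by continuity (`IsOuterSolution.exists_near`) small disturbances
preserve the strict inequalities. Afterwards the local contraction takes over. -/

set_option linter.unusedSectionVars false

/-! ### Real positive semidefinite matrices, traces and the Frobenius norm. -/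

section PosSemidefLemmas

attribute [local instance] Matrix.frobeniusNormedSpace

variable {ι κ : Type*} [Fintype ι] [DecidableEq ι] [Fintype κ] [DecidableEq κ]

theorem posSemidef_iff_real {M : Matrix ι ι ℝ} :
    M.PosSemidef ↔ Mᵀ = M ∧ ∀ x, 0 ≤ x ⬝ᵥ M *ᵥ x := by
  rw [posSemidef_iff_dotProduct_mulVec, IsHermitian, conjTranspose_eq_transpose_of_trivial]
  simp

theorem posDef_iff_real {M : Matrix ι ι ℝ} :
    M.PosDef ↔ Mᵀ = M ∧ ∀ x, x ≠ 0 → 0 < x ⬝ᵥ M *ᵥ x := by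
  rw [posDef_iff_dotProduct_mulVec, IsHermitian, conjTranspose_eq_transpose_of_trivial]
  simp

theorem Matrix.PosSemidef.transpose_eq {M : Matrix ι ι ℝ} (h : M.PosSemidef) : Mᵀ = M :=
  (posSemidef_iff_real.1 h).1

theorem Matrix.PosSemidef.quad_nonneg {M : Matrix ι ι ℝ} (h : M.PosSemidef) (x : ι → ℝ) :
    0 ≤ x ⬝ᵥ M *ᵥ x :=
  (posSemidef_iff_real.1 h).2 x

theorem Matrix.PosDef.transpose_eq {M : Matrix ι ι ℝ} (h : M.PosDef) : Mᵀ = M :=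
  (posDef_iff_real.1 h).1

theorem Matrix.PosDef.quad_pos {M : Matrix ι ι ℝ} (h : M.PosDef) {x : ι → ℝ} (hx : x ≠ 0) :
    0 < x ⬝ᵥ M *ᵥ x :=
  (posDef_iff_real.1 h).2 x hx

theorem Matrix.PosSemidef.mulVec_eq_zero {M : Matrix ι ι ℝ} (h : M.PosSemidef) {x : ι → ℝ}
    (hx : x ⬝ᵥ M *ᵥ x = 0) : M *ᵥ x = 0 :=
  (h.dotProduct_mulVec_zero_iff x).1 (by simpa using hx)

theorem Matrix.PosSemidef.transpose_conj {W : Matrix ι ι ℝ} (h : W.PosSemidef)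
    (H : Matrix ι κ ℝ) : (Hᵀ * W * H).PosSemidef := by
  simpa [conjTranspose_eq_transpose_of_trivial] using h.conjTranspose_mul_mul_same H

theorem posSemidef_transpose_mul_self (H : Matrix κ ι ℝ) : (Hᵀ * H).PosSemidef := by
  simpa [conjTranspose_eq_transpose_of_trivial] using posSemidef_conjTranspose_mul_self H

open scoped MatrixOrder ComplexOrder in
theorem Matrix.PosSemidef.exists_transpose_mul_self {X : Matrix ι ι ℝ} (h : X.PosSemidef) :
    ∃ B : Matrix ι ι ℝ, X = Bᵀ * B := by
  obtain ⟨B, hB⟩ := CStarAlgebra.nonneg_iff_eq_star_mul_self.mp h.nonneg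
  exact ⟨B, by simpa [star_eq_conjTranspose, conjTranspose_eq_transpose_of_trivial] using hB⟩

theorem trace_mul_nonneg {P X : Matrix ι ι ℝ} (hP : P.PosSemidef) (hX : X.PosSemidef) :
    0 ≤ (P * X).trace := by
  obtain ⟨B, rfl⟩ := hX.exists_transpose_mul_self
  rw [← Matrix.mul_assoc, trace_mul_comm, ← Matrix.mul_assoc]
  simpa using (hP.transpose_conj Bᵀ).trace_nonneg

theorem trace_transpose_mul_self_eq_zero {M : Matrix κ ι ℝ} (h : (Mᵀ * M).trace = 0) : M = 0 := by
  rw [← conjTranspose_eq_transpose_of_trivial] at h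
  exact trace_conjTranspose_mul_self_eq_zero_iff.1 h

/-- With `X = Bᵀ B` the trace is the squared Frobenius norm of `M Bᵀ`. This is how a vanishing cost
along a second moment `X` becomes an identity for `X`. -/
theorem mul_eq_zero_of_trace_le_zero {M : Matrix κ ι ℝ} {X : Matrix ι ι ℝ} (hX : X.PosSemidef)
    (h : (Mᵀ * M * X).trace ≤ 0) : M * X = 0 := by
  have h' : (Mᵀ * M * X).trace = 0 :=
    le_antisymm h (trace_mul_nonneg (posSemidef_transpose_mul_self M) hX)
  obtain ⟨B, rfl⟩ := hX.exists_transpose_mul_self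
  have : (M * Bᵀ) = 0 := by
    apply trace_transpose_mul_self_eq_zero
    rw [← h', ← Matrix.mul_assoc (Mᵀ * M), trace_mul_comm _ B, transpose_mul, transpose_transpose]
    simp [Matrix.mul_assoc]
  rw [← Matrix.mul_assoc, this, Matrix.zero_mul]

theorem frobenius_norm_sq (X : Matrix κ ι ℝ) : ‖X‖ ^ 2 = (Xᵀ * X).trace := by
  rw [frobenius_norm_def, ← Real.sqrt_eq_rpow, Real.sq_sqrt (by positivity)]
  simp only [trace, diag, mul_apply, transpose_apply]
  rw [Finset.sum_comm]
  simp [sq]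

theorem Matrix.PosSemidef.norm_le_trace {X : Matrix ι ι ℝ} (h : X.PosSemidef) :
    ‖X‖ ≤ X.trace := by
  obtain ⟨B, rfl⟩ := h.exists_transpose_mul_self
  calc ‖Bᵀ * B‖ ≤ ‖Bᵀ‖ * ‖B‖ := frobenius_norm_mul _ _
    _ = ‖B‖ ^ 2 := by rw [frobenius_norm_transpose, sq]
    _ = _ := frobenius_norm_sq B

theorem Matrix.PosSemidef.eq_zero_of_trace {X : Matrix ι ι ℝ} (h : X.PosSemidef)
    (h0 : X.trace ≤ 0) : X = 0 :=
  norm_le_zero_iff.1 (h.norm_le_trace.trans h0)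

theorem Matrix.PosSemidef.eq_zero_of_neg {X : Matrix ι ι ℝ} (h : X.PosSemidef)
    (h' : (-X).PosSemidef) : X = 0 :=
  h.eq_zero_of_trace (by simpa using h'.trace_nonneg)

theorem isClosed_posSemidef : IsClosed {M : Matrix ι ι ℝ | M.PosSemidef} := by
  simp_rw [posSemidef_iff_real, Set.ofPred_and, Set.ofPred_forall]
  refine (isClosed_eq (by fun_prop) continuous_id).inter (isClosed_iInter fun x => ?_)
  exact isClosed_le continuous_const
    (continuous_const.dotProduct (continuous_id.matrix_mulVec continuous_const))

theorem posDef_of_posSemidef_of_ne {M : Matrix ι ι ℝ} (h : M.PosSemidef)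
    (h' : ∀ x, M *ᵥ x = 0 → x = 0) : M.PosDef :=
  posDef_iff_real.2 ⟨h.transpose_eq, fun x hx => lt_of_le_of_ne (h.quad_nonneg x) fun h0 =>
    hx (h' x (h.mulVec_eq_zero h0.symm))⟩

/-- The generalized Rayleigh quotient attains its minimum `m` on the compact unit sphere, and
homogeneity makes the bound global. Thus `X - m • Y` touches the boundary of the positive
semidefinite cone, at `x`. -/
theorem exists_min_quad_ratio [Nonempty ι] {X Y : Matrix ι ι ℝ} (hY : Y.PosDef) (hX : Xᵀ = X) :
    ∃ (m : ℝ) (x : ι → ℝ), x ≠ 0 ∧ (X - m • Y).PosSemidef ∧ x ⬝ᵥ (X - m • Y) *ᵥ x = 0 := by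
  have hne : (Metric.sphere (0 : ι → ℝ) 1).Nonempty := (NormedSpace.sphere_nonempty).2 zero_le_one
  have h0 : ∀ x ∈ Metric.sphere (0 : ι → ℝ) 1, x ≠ 0 := by
    rintro x hx rfl
    simp at hx
  have hq : ∀ M : Matrix ι ι ℝ, Continuous fun x : ι → ℝ => x ⬝ᵥ M *ᵥ x := fun M =>
    continuous_id.dotProduct (continuous_const.matrix_mulVec continuous_id)
  have hc : ContinuousOn (fun x => (x ⬝ᵥ X *ᵥ x) / (x ⬝ᵥ Y *ᵥ x)) (Metric.sphere (0 : ι → ℝ) 1) :=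
    (hq X).continuousOn.div (hq Y).continuousOn fun x hx => (hY.quad_pos (h0 x hx)).ne'
  obtain ⟨x, hx, hmin⟩ := (isCompact_sphere (0 : ι → ℝ) 1).exists_isMinOn hne hc
  refine ⟨(x ⬝ᵥ X *ᵥ x) / (x ⬝ᵥ Y *ᵥ x), x, h0 x hx,
    posSemidef_iff_real.2 ⟨by simp [hX, hY.transpose_eq], fun y => ?_⟩, ?_⟩
  · rcases eq_or_ne y 0 with rfl | hy
    · simp
    have hny : ‖y‖ ≠ 0 := by simpa using hy
    have hm := hmin (show (‖y‖⁻¹ • y) ∈ Metric.sphere (0 : ι → ℝ) 1 by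
      simp [norm_smul, hny])
    simp only [Set.mem_ofPred_eq, mulVec_smul, dotProduct_smul, smul_dotProduct, smul_eq_mul] at hm
    rw [mul_div_mul_left _ _ (inv_ne_zero hny), mul_div_mul_left _ _ (inv_ne_zero hny),
      le_div_iff₀ (hY.quad_pos hy)] at hm
    simpa [sub_mulVec, smul_mulVec] using hm
  · have := (hY.quad_pos (h0 x hx)).ne'
    simp only [sub_mulVec, smul_mulVec, dotProduct_sub, dotProduct_smul, smul_eq_mul]
    field_simp
    simp

theorem abs_trace_mul_le (A B : Matrix ι ι ℝ) : |(A * B).trace| ≤ ‖A‖ * ‖B‖ := by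
  have := Finset.sum_mul_sq_le_sq_mul_sq (Finset.univ : Finset (ι × ι)) (fun p => A p.1 p.2)
    (fun p => B p.2 p.1)
  have hA : ‖A‖ ^ 2 = ∑ p : ι × ι, A p.1 p.2 ^ 2 := by
    rw [frobenius_norm_sq, Fintype.sum_prod_type, Finset.sum_comm]
    simp [trace, mul_apply, sq]
  have hB : ‖B‖ ^ 2 = ∑ p : ι × ι, B p.2 p.1 ^ 2 := by
    rw [frobenius_norm_sq, Fintype.sum_prod_type]
    simp [trace, mul_apply, sq]
  have hAB : (A * B).trace = ∑ p : ι × ι, A p.1 p.2 * B p.2 p.1 := by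
    rw [Fintype.sum_prod_type]
    simp [trace, mul_apply]
  rw [← hA, ← hB, ← hAB, ← mul_pow] at this
  exact abs_le_of_sq_le_sq this (by positivity)

theorem abs_quad_le (E : Matrix ι ι ℝ) (y : ι → ℝ) : |y ⬝ᵥ E *ᵥ y| ≤ ‖E‖ * (y ⬝ᵥ y) := by
  have e1 : y ⬝ᵥ E *ᵥ y = (E * vecMulVec y y).trace := by
    rw [mul_vecMulVec, trace_vecMulVec, dotProduct_comm]
  have e2 : ‖vecMulVec y y‖ ≤ y ⬝ᵥ y := by
    have : (vecMulVec y y).PosSemidef := by simpa using posSemidef_vecMulVec_self_star y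
    simpa [trace_vecMulVec] using this.norm_le_trace
  rw [e1]
  exact (abs_trace_mul_le _ _).trans (by gcongr)

theorem Matrix.PosDef.exists_pos_le_quad {X : Matrix ι ι ℝ} (hX : X.PosDef) :
    ∃ m : ℝ, 0 < m ∧ ∀ y, m * (y ⬝ᵥ y) ≤ y ⬝ᵥ X *ᵥ y := by
  cases isEmpty_or_nonempty ι
  · exact ⟨1, one_pos, fun y => by simp [dotProduct]⟩
  obtain ⟨m, x, hx, hm, hm0⟩ := exists_min_quad_ratio PosDef.one hX.transpose_eq
  simp only [sub_mulVec, smul_mulVec, dotProduct_sub, dotProduct_smul, smul_eq_mul,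
    one_mulVec] at hm0
  refine ⟨m, ?_, fun y => ?_⟩
  · have h1 := hX.quad_pos hx
    have h2 : 0 ≤ x ⬝ᵥ x := by simpa using (PosSemidef.one (R := ℝ)).quad_nonneg x
    by_contra hm'
    nlinarith
  · have := hm.quad_nonneg y
    simp only [sub_mulVec, smul_mulVec, dotProduct_sub, dotProduct_smul, smul_eq_mul,
      one_mulVec] at this
    linarith

theorem Matrix.PosDef.exists_add_posDef {X : Matrix ι ι ℝ} (hX : X.PosDef) :
    ∃ t : ℝ, 0 < t ∧ ∀ E : Matrix ι ι ℝ, Eᵀ = E → ‖E‖ < t → (X + E).PosDef := by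
  obtain ⟨t, ht, h⟩ := hX.exists_pos_le_quad
  refine ⟨t, ht, fun E hE hEt => ?_⟩
  refine posDef_iff_real.2 ⟨by simp [hE, hX.transpose_eq], fun y hy => ?_⟩
  have h1 := (abs_le.1 (abs_quad_le E y)).1
  have h2 := h y
  have h3 : 0 < y ⬝ᵥ y := by simpa using (PosDef.one (R := ℝ)).quad_pos hy
  rw [add_mulVec, dotProduct_add]
  nlinarith

theorem Matrix.PosDef.eventually_posDef {α : Type*} {l : Filter α} {X : Matrix ι ι ℝ}
    (hX : X.PosDef) {f : α → Matrix ι ι ℝ} (hf : Tendsto f l (𝓝 X)) (hs : ∀ a, (f a)ᵀ = f a) :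
    ∀ᶠ a in l, (f a).PosDef := by
  obtain ⟨t, ht, h⟩ := hX.exists_add_posDef
  filter_upwards [(Metric.tendsto_nhds.1 hf) t ht] with a ha
  rw [dist_eq_norm] at ha
  simpa using h (f a - X) (by simp [hs, hX.transpose_eq]) ha

end PosSemidefLemmas

/-! ### Lyapunov operators: resolvent positivity, solvability, and the Perron–Frobenius dichotomy.
-/

section LyapunovOperator

attribute [local instance] Matrix.frobeniusNormedSpace

variable {ι κ : Type*} [Fintype ι] [DecidableEq ι] [Fintype κ] [DecidableEq κ]

/-- The generalized Lyapunov operator `P ↦ Fᵀ P + P F + Hᵀ P H` as a linear map, for matrices with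
an arbitrary finite index type. -/
def lyap (F H : Matrix ι ι ℝ) : Matrix ι ι ℝ →ₗ[ℝ] Matrix ι ι ℝ where
  toFun P := Fᵀ * P + P * F + Hᵀ * P * H
  map_add' P P' := by noncomm_ring
  map_smul' c P := by simp [smul_add]

theorem lyap_apply (F H P : Matrix ι ι ℝ) : lyap F H P = Fᵀ * P + P * F + Hᵀ * P * H := rfl

theorem lyap_transpose (F H P : Matrix ι ι ℝ) : (lyap F H P)ᵀ = lyap F H Pᵀ := by
  simp only [lyap_apply, transpose_add, transpose_mul, transpose_transpose, Matrix.mul_assoc]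
  abel

theorem lyap_transpose_eq {F H P : Matrix ι ι ℝ} (h : Pᵀ = P) : (lyap F H P)ᵀ = lyap F H P := by
  rw [lyap_transpose, h]

theorem lyap_add_smul_one (F H P : Matrix ι ι ℝ) (s : ℝ) :
    lyap (F + s • 1) H P = lyap F H P + (2 * s) • P := by
  simp only [lyap_apply, transpose_add, transpose_smul, transpose_one, Matrix.add_mul,
    Matrix.mul_add, Matrix.smul_mul, Matrix.mul_smul, Matrix.one_mul, Matrix.mul_one, two_mul,
    add_smul]
  abel

theorem lyap_sub_smul_one (F H P : Matrix ι ι ℝ) (s : ℝ) :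
    lyap (F - s • 1) H P = lyap F H P - (2 * s) • P := by
  have := lyap_add_smul_one F H P (-s)
  simpa [sub_eq_add_neg] using this

/-- At a null vector of `W` the quadratic form of `lyap F H W` is the one of `Hᵀ W H`. -/
theorem quad_lyap_of_mulVec_eq_zero {F H W : Matrix ι ι ℝ} (hW : W.PosSemidef) {x : ι → ℝ}
    (hx : W *ᵥ x = 0) : 0 ≤ x ⬝ᵥ lyap F H W *ᵥ x := by
  have h1 : x ⬝ᵥ (W * F) *ᵥ x = 0 := by
    rw [← mulVec_mulVec, dotProduct_mulVec, ← mulVec_transpose, hW.transpose_eq, hx,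
      zero_dotProduct]
  have h2 : x ⬝ᵥ (Fᵀ * W) *ᵥ x = 0 := by
    rw [← mulVec_mulVec, hx, mulVec_zero, dotProduct_zero]
  rw [lyap_apply, add_mulVec, add_mulVec, dotProduct_add, dotProduct_add, h1, h2]
  simpa using (hW.transpose_conj H).quad_nonneg x

/-- Mean square stability of `dx = F x dt + H x dw`, by a quadratic Lyapunov function. -/
def MSStable (F H : Matrix ι ι ℝ) : Prop :=
  ∃ Y : Matrix ι ι ℝ, Y.PosDef ∧ (-(lyap F H Y)).PosDef

theorem MSStable.of_isEmpty [IsEmpty ι] (F H : Matrix ι ι ℝ) : MSStable F H := by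
  have h : ∀ M : Matrix ι ι ℝ, M.PosDef := fun M =>
    posDef_iff_real.2 ⟨by ext i; exact isEmptyElim i, fun x hx => (hx (Subsingleton.elim _ _)).elim⟩
  exact ⟨0, h _, h _⟩

/-- The resolvent positivity of a stable Lyapunov operator. -/
theorem MSStable.posSemidef {F H X : Matrix ι ι ℝ} (h : MSStable F H) (hX : Xᵀ = X)
    (hL : (-(lyap F H X)).PosSemidef) : X.PosSemidef := by
  cases isEmpty_or_nonempty ι
  · exact posSemidef_iff_real.2 ⟨hX, fun x => by simp [dotProduct]⟩
  obtain ⟨Y, hY, hLY⟩ := h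
  obtain ⟨m, x, hx, hm, hm0⟩ := exists_min_quad_ratio hY hX
  -- If `m < 0`, the form of `lyap F H (X - m • Y)` at the touching vector `x` would be negative, as
  -- `lyap F H X ≤ 0` and `lyap F H Y < 0`. But it is nonnegative at a null vector.
  have hm' : 0 ≤ m := by
    by_contra hneg
    have h1 := quad_lyap_of_mulVec_eq_zero (F := F) (H := H) hm (hm.mulVec_eq_zero hm0)
    have h2 := hL.quad_nonneg x
    have h3 := hLY.quad_pos hx
    simp only [map_sub, map_smul, sub_mulVec, smul_mulVec, dotProduct_sub, dotProduct_smul,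
      smul_eq_mul, neg_mulVec, dotProduct_neg] at h1 h2 h3
    nlinarith
  simpa using hm.add (hY.posSemidef.smul hm')

theorem MSStable.neg_posSemidef {F H X : Matrix ι ι ℝ} (h : MSStable F H) (hX : Xᵀ = X)
    (hL : (lyap F H X).PosSemidef) : (-X).PosSemidef :=
  h.posSemidef (by simp [hX]) (by simpa using hL)

theorem MSStable.eq_zero {F H X : Matrix ι ι ℝ} (h : MSStable F H) (hX : Xᵀ = X)
    (hL : lyap F H X = 0) : X = 0 :=
  (h.posSemidef hX (by rw [hL, neg_zero]; exact PosSemidef.zero)).eq_zero_of_neg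
    (h.neg_posSemidef hX (by rw [hL]; exact PosSemidef.zero))

variable (ι) in
/-- The subspace of symmetric matrices. -/
def symmMatrices : Submodule ℝ (Matrix ι ι ℝ) where
  carrier := {X | Xᵀ = X}
  add_mem' {X Y} hX hY := by
    change (X + Y)ᵀ = X + Y
    rw [transpose_add, show Xᵀ = X from hX, show Yᵀ = Y from hY]
  zero_mem' := transpose_zero
  smul_mem' c X hX := by
    change (c • X)ᵀ = c • X
    rw [transpose_smul, show Xᵀ = X from hX]

/-- The generalized Lyapunov operator on symmetric matrices. -/
def lyapSymm (F H : Matrix ι ι ℝ) : symmMatrices ι →ₗ[ℝ] symmMatrices ι :=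
  (lyap F H).restrict fun _ hX => lyap_transpose_eq hX

theorem MSStable.ker_lyapSymm {F H : Matrix ι ι ℝ} (h : MSStable F H) :
    (lyapSymm F H).ker = ⊥ :=
  LinearMap.ker_eq_bot'.2 fun X hX => Subtype.ext (h.eq_zero X.2 (congrArg Subtype.val hX))

theorem MSStable.exists_lyap_eq {F H E : Matrix ι ι ℝ} (h : MSStable F H) (hE : Eᵀ = E) :
    ∃ X : Matrix ι ι ℝ, Xᵀ = X ∧ lyap F H X = E := by
  have hs := LinearMap.injective_iff_surjective.1 (LinearMap.ker_eq_bot.1 h.ker_lyapSymm)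
  obtain ⟨X, hX⟩ := hs ⟨E, hE⟩
  exact ⟨X, X.2, congrArg Subtype.val hX⟩

/-- If `-(lyap F H Y) ≥ m`, resolvent positivity traps `X` between `±(‖lyap F H X‖ / m) • Y`, and
traces of positive semidefinite matrices bound norms. The summand `1` in the constant only secures
strict positivity. -/
theorem MSStable.exists_norm_le {F H : Matrix ι ι ℝ} (h : MSStable F H) :
    ∃ M : ℝ, 0 < M ∧ ∀ X : Matrix ι ι ℝ, Xᵀ = X → ‖X‖ ≤ M * ‖lyap F H X‖ := by
  obtain ⟨Y, hY, hL⟩ := id h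
  obtain ⟨m, hm, hle⟩ := hL.exists_pos_le_quad
  have key : ∀ X : Matrix ι ι ℝ, Xᵀ = X → ((‖lyap F H X‖ / m) • Y + X).PosSemidef := by
    intro X hX
    refine h.posSemidef (by simp [hX, hY.transpose_eq])
      (posSemidef_iff_real.2 ⟨?_, fun y => ?_⟩)
    · rw [transpose_neg, lyap_transpose_eq (by simp [hX, hY.transpose_eq])]
    · have h1 := (abs_le.1 (abs_quad_le (lyap F H X) y)).2
      have h2 := mul_le_mul_of_nonneg_left (hle y) (div_nonneg (norm_nonneg (lyap F H X)) hm.le)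
      rw [← mul_assoc, div_mul_cancel₀ _ hm.ne'] at h2
      simp only [map_add, map_smul, neg_add, add_mulVec, neg_mulVec, smul_mulVec, dotProduct_add,
        dotProduct_neg, dotProduct_smul, smul_eq_mul, mul_neg] at h2 ⊢
      linarith
  refine ⟨(2 * Y.trace + ‖Y‖) / m + 1, ?_, fun X hX => ?_⟩
  · have := hY.posSemidef.trace_nonneg
    positivity
  · have h1 := (key X hX).norm_le_trace
    have h2 := (key (-X) (by simp [hX])).trace_nonneg
    have h3 : ‖X‖ ≤ ‖(‖lyap F H X‖ / m) • Y + X‖ + ‖(‖lyap F H X‖ / m) • Y‖ := by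
      simpa using norm_sub_le ((‖lyap F H X‖ / m) • Y + X) ((‖lyap F H X‖ / m) • Y)
    rw [norm_smul, Real.norm_of_nonneg (by positivity)] at h3
    simp only [map_neg, norm_neg, trace_add, trace_neg, trace_smul, smul_eq_mul] at h1 h2
    have h4 : ((2 * Y.trace + ‖Y‖) / m + 1) * ‖lyap F H X‖
        = ‖lyap F H X‖ / m * (2 * Y.trace) + ‖lyap F H X‖ / m * ‖Y‖ + ‖lyap F H X‖ := by ring
    rw [h4]
    nlinarith [norm_nonneg (lyap F H X)]

/-- For the trace pairing the adjoint of the Lyapunov operator is the generator `X ↦ F X + X Fᵀ + H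
X Hᵀ` of the second moments. -/
theorem trace_lyap_mul (F H P X : Matrix ι ι ℝ) :
    (lyap F H P * X).trace = (P * lyap Fᵀ Hᵀ X).trace := by
  simp only [lyap_apply, Matrix.add_mul, Matrix.mul_add, trace_add, transpose_transpose]
  rw [Matrix.mul_assoc, trace_mul_comm Fᵀ, Matrix.mul_assoc Hᵀ, Matrix.mul_assoc Hᵀ,
    trace_mul_comm Hᵀ]
  simp only [Matrix.mul_assoc]
  ring

theorem MSStable.of_posSemidef_of_posDef {F H W E : Matrix ι ι ℝ} (hW : W.PosSemidef)
    (hE : E.PosDef) (hL : lyap F H W = -E) : MSStable F H := by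
  refine ⟨W, posDef_of_posSemidef_of_ne hW fun x hx => ?_, by rwa [hL, neg_neg]⟩
  by_contra hx0
  have h1 := quad_lyap_of_mulVec_eq_zero (F := F) (H := H) hW hx
  have h2 := hE.quad_pos hx0
  rw [hL, neg_mulVec, dotProduct_neg] at h1
  linarith

theorem MSStable.of_lyap_eq {F H Z : Matrix ι ι ℝ} (hZ : Z.PosSemidef) {c : ℝ} (hc : 0 < c)
    (h : lyap F H Z = -(c • 1)) : MSStable F H :=
  .of_posSemidef_of_posDef hZ (PosDef.one.smul hc) h

/-- Normalizing the trace keeps `Z` in a compact set; loss of stability in a limit then shows up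
only as `c → 0`. -/
theorem MSStable.exists_lyap_eq_neg [Nonempty ι] {F H : Matrix ι ι ℝ} (h : MSStable F H) :
    ∃ (Z : Matrix ι ι ℝ) (c : ℝ), Z.PosSemidef ∧ Z.trace = 1 ∧ 0 < c ∧
      lyap F H Z = -(c • 1) := by
  obtain ⟨Z, hZ, hL⟩ := h.exists_lyap_eq (E := -1) (by simp)
  have hp := h.posSemidef hZ (by rw [hL, neg_neg]; exact PosSemidef.one)
  have ht : 0 < Z.trace := by
    by_contra h0
    have := hp.eq_zero_of_trace (not_lt.1 h0)
    rw [this, map_zero] at hL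
    simpa using congrFun₂ hL (Classical.arbitrary ι) (Classical.arbitrary ι)
  refine ⟨Z.trace⁻¹ • Z, Z.trace⁻¹, hp.smul (inv_nonneg.2 ht.le), ?_, inv_pos.2 ht, ?_⟩
  · rw [trace_smul, smul_eq_mul, inv_mul_cancel₀ ht.ne']
  · rw [map_smul, hL, smul_neg]

theorem isCompact_posSemidef_trace_le (r : ℝ) :
    IsCompact {Z : Matrix ι ι ℝ | Z.PosSemidef ∧ Z.trace ≤ r} := by
  have : ProperSpace (Matrix ι ι ℝ) := FiniteDimensional.proper ℝ _
  refine (isCompact_closedBall (0 : Matrix ι ι ℝ) r).of_isClosed_subset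
    (isClosed_posSemidef.inter (isClosed_le continuous_id.matrix_trace continuous_const)) ?_
  rintro Z ⟨hZ, ht⟩
  simpa using hZ.norm_le_trace.trans ht

/-- A limit of stable systems is stable or has a positive semidefinite null vector. -/
theorem MSStable.of_tendsto [Nonempty ι] {F H : Matrix ι ι ℝ} {Fs Hs : ℕ → Matrix ι ι ℝ}
    (hF : Tendsto Fs atTop (𝓝 F)) (hH : Tendsto Hs atTop (𝓝 H)) (h : ∀ k, MSStable (Fs k) (Hs k)) :
    MSStable F H ∨ ∃ Z : Matrix ι ι ℝ, Z.PosSemidef ∧ Z.trace = 1 ∧ lyap F H Z = 0 := by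
  have : FirstCountableTopology (Matrix ι ι ℝ) :=
    inferInstanceAs (FirstCountableTopology (ι → ι → ℝ))
  choose Z c hZ ht hc hL using fun k => (h k).exists_lyap_eq_neg
  obtain ⟨Z₀, ⟨hZ₀, -⟩, φ, hφ, hlim⟩ :=
    (isCompact_posSemidef_trace_le (ι := ι) 1).tendsto_subseq fun k => ⟨hZ k, (ht k).le⟩
  have ht₀ : Z₀.trace = 1 := by
    refine tendsto_nhds_unique ((continuous_id.matrix_trace.tendsto Z₀).comp hlim) ?_
    simp [Function.comp_def, ht]
  have hF' := hF.comp hφ.tendsto_atTop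
  have hH' := hH.comp hφ.tendsto_atTop
  have hT : ∀ {u : ℕ → Matrix ι ι ℝ} {a}, Tendsto u atTop (𝓝 a) →
      Tendsto (fun k => (u k)ᵀ) atTop (𝓝 aᵀ) := fun hu =>
    (continuous_id.matrix_transpose.tendsto _).comp hu
  have hM : ∀ {u v : ℕ → Matrix ι ι ℝ} {a b}, Tendsto u atTop (𝓝 a) → Tendsto v atTop (𝓝 b) →
      Tendsto (fun k => u k * v k) atTop (𝓝 (a * b)) := fun hu hv =>
    ((continuous_fst.matrix_mul continuous_snd).tendsto (_, _)).comp (hu.prodMk_nhds hv)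
  have hlimL : Tendsto (fun k => lyap (Fs (φ k)) (Hs (φ k)) (Z (φ k))) atTop
      (𝓝 (lyap F H Z₀)) :=
    ((hM (hT hF') hlim).add (hM hlim hF')).add (hM (hM (hT hH') hlim) hH')
  -- Any diagonal entry of `lyap F H Z = -(c • 1)` recovers `c`, so the constants converge along
  -- with the matrices. A positive limit gives stability, a zero limit the null vector.
  let i₀ := Classical.arbitrary ι
  have hcl : Tendsto (fun k => c (φ k)) atTop (𝓝 (-(lyap F H Z₀ i₀ i₀))) := by
    have := (((continuous_id.matrix_elem i₀ i₀).tendsto _).comp hlimL).neg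
    refine this.congr fun k => ?_
    simp [hL]
  have hL₀ : lyap F H Z₀ = -((-(lyap F H Z₀ i₀ i₀)) • 1) := by
    refine tendsto_nhds_unique hlimL ?_
    simp_rw [hL]
    exact (hcl.smul_const _).neg
  have hc0 : 0 ≤ -(lyap F H Z₀ i₀ i₀) := ge_of_tendsto' hcl fun k => (hc _).le
  rcases hc0.eq_or_lt with h0 | h0
  · right
    refine ⟨Z₀, hZ₀, ht₀, ?_⟩
    rw [hL₀, ← h0]
    simp
  · exact Or.inl (MSStable.of_lyap_eq hZ₀ h0 hL₀)

theorem MSStable.sub_smul_one {F H : Matrix ι ι ℝ} (h : MSStable F H) {s : ℝ} (hs : 0 ≤ s) :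
    MSStable (F - s • 1) H := by
  obtain ⟨Y, hY, hL⟩ := h
  refine ⟨Y, hY, ?_⟩
  rw [lyap_sub_smul_one, neg_sub, sub_eq_add_neg]
  exact hL.posSemidef_add (hY.posSemidef.smul (by positivity))

theorem MSStable.exists_add_smul_one {F H : Matrix ι ι ℝ} (h : MSStable F H) :
    ∃ t : ℝ, 0 < t ∧ ∀ s, s < t → MSStable (F + s • 1) H := by
  obtain ⟨Y, hY, hL⟩ := h
  obtain ⟨t, ht, hE⟩ := hL.exists_add_posDef
  have key : MSStable (F + (t / (4 * (‖Y‖ + 1))) • 1) H := by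
    refine ⟨Y, hY, ?_⟩
    rw [lyap_add_smul_one, neg_add]
    refine hE _ (by simp [hY.transpose_eq]) ?_
    rw [norm_neg, norm_smul, Real.norm_of_nonneg (by positivity)]
    have : 0 ≤ ‖Y‖ := norm_nonneg Y
    rw [← mul_div_assoc, div_mul_eq_mul_div, div_lt_iff₀ (by positivity)]
    nlinarith
  refine ⟨_, div_pos ht (by positivity : 0 < 4 * (‖Y‖ + 1)), fun s hs => ?_⟩
  have := key.sub_smul_one (s := t / (4 * (‖Y‖ + 1)) - s) (by linarith)
  rwa [add_sub_assoc, ← sub_smul, sub_sub_cancel] at this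

theorem exists_msStable_sub_smul_one (F H : Matrix ι ι ℝ) :
    ∃ s : ℝ, 0 ≤ s ∧ MSStable (F - s • 1) H := by
  refine ⟨‖lyap F H 1‖ + 1, by positivity, 1, PosDef.one, posDef_iff_real.2
    ⟨by rw [transpose_neg, lyap_transpose_eq (transpose_one)], fun y hy => ?_⟩⟩
  have h1 := (abs_le.1 (abs_quad_le (lyap F H 1) y)).2
  have h2 : 0 < y ⬝ᵥ y := by simpa using (PosDef.one (R := ℝ)).quad_pos hy
  rw [lyap_sub_smul_one]
  simp only [neg_sub, sub_mulVec, smul_mulVec, dotProduct_sub, dotProduct_smul,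
    one_mulVec, smul_eq_mul]
  nlinarith [norm_nonneg (lyap F H 1)]

/-- Either the system is stable or its Lyapunov operator has a nonnegative eigenvalue with a
positive semidefinite eigenvector. -/
theorem msStable_or_exists_eigenvector (F H : Matrix ι ι ℝ) :
    MSStable F H ∨ ∃ (μ : ℝ) (Z : Matrix ι ι ℝ), 0 ≤ μ ∧ Z.PosSemidef ∧ Z ≠ 0 ∧
      lyap F H Z = μ • Z := by
  cases isEmpty_or_nonempty ι
  · exact Or.inl (MSStable.of_isEmpty F H)
  -- Take the least shift that stabilizes. If the system shifted by a positive infimum were stable,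
  -- openness would allow a smaller shift; otherwise the limit null vector is an eigenvector for the
  -- eigenvalue `2 * sInf Λ`.
  let Λ : Set ℝ := {s | 0 ≤ s ∧ MSStable (F - s • 1) H}
  have hne : Λ.Nonempty := exists_msStable_sub_smul_one F H
  have hbdd : BddBelow Λ := ⟨0, fun s hs => hs.1⟩
  obtain ⟨u, -, hu, huΛ⟩ := exists_seq_tendsto_sInf hne hbdd
  have h0 : 0 ≤ sInf Λ := le_csInf hne fun s hs => hs.1
  have hF : Tendsto (fun k => F - u k • (1 : Matrix ι ι ℝ)) atTop (𝓝 (F - sInf Λ • 1)) :=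
    tendsto_const_nhds.sub (hu.smul_const _)
  rcases MSStable.of_tendsto hF tendsto_const_nhds fun k => (huΛ k).2 with h | ⟨Z, hZ, ht, hL⟩
  · left
    rcases h0.eq_or_lt with h0 | h0
    · simpa [← h0] using h
    · obtain ⟨t, ht, hst⟩ := h.exists_add_smul_one
      have hm : 0 < min (t / 2) (sInf Λ) := lt_min (by linarith) h0
      have hmem : sInf Λ - min (t / 2) (sInf Λ) ∈ Λ := by
        refine ⟨by linarith [min_le_right (t / 2) (sInf Λ)], ?_⟩
        have := hst (min (t / 2) (sInf Λ)) (by linarith [min_le_left (t / 2) (sInf Λ)])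
        rwa [sub_add, ← sub_smul] at this
      linarith [csInf_le hbdd hmem]
  · right
    refine ⟨2 * sInf Λ, Z, by positivity, hZ, ?_, ?_⟩
    · rintro rfl
      simp at ht
    · rwa [lyap_sub_smul_one, sub_eq_zero] at hL

theorem trace_mul_pos {P X : Matrix ι ι ℝ} (hP : P.PosDef) (hX : X.PosSemidef) (h0 : X ≠ 0) :
    0 < (P * X).trace := by
  obtain ⟨m, hm, hle⟩ := hP.exists_pos_le_quad
  have h1 : (P - m • 1).PosSemidef := posSemidef_iff_real.2
    ⟨by simp [hP.transpose_eq], fun y => by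
      simpa [sub_mulVec, smul_mulVec] using hle y⟩
  have h2 := trace_mul_nonneg h1 hX
  have h3 : 0 < X.trace := by
    by_contra hneg
    exact h0 (hX.eq_zero_of_trace (not_lt.1 hneg))
  rw [Matrix.sub_mul, trace_sub, Matrix.smul_mul, Matrix.one_mul, trace_smul, smul_eq_mul] at h2
  nlinarith

/-- Pairing with the Lyapunov function `Y` gives `tr (lyap F H Y * X) = μ tr (Y X) ≥ 0`, whereas the
left side is negative unless `X = 0`. -/
theorem MSStable.dual_eigenvector_eq_zero {F H X : Matrix ι ι ℝ} (h : MSStable F H)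
    (hX : X.PosSemidef) {μ : ℝ} (hμ : 0 ≤ μ) (hL : lyap Fᵀ Hᵀ X = μ • X) : X = 0 := by
  obtain ⟨Y, hY, hLY⟩ := h
  by_contra h0
  have h1 := trace_mul_pos hLY hX h0
  rw [Matrix.neg_mul, trace_neg, trace_lyap_mul, hL, Matrix.mul_smul, trace_smul, smul_eq_mul] at h1
  nlinarith [trace_mul_nonneg hY.posSemidef hX]

/-- An unstable system has a nonnegative eigenvalue with a positive semidefinite eigenvector for
the second moment operator `X ↦ F X + X Fᵀ + H X Hᵀ`. -/
theorem exists_dual_eigenvector {F H : Matrix ι ι ℝ} (h : ¬ MSStable F H) :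
    ∃ (μ : ℝ) (X : Matrix ι ι ℝ), 0 ≤ μ ∧ X.PosSemidef ∧ X ≠ 0 ∧ lyap Fᵀ Hᵀ X = μ • X := by
  -- The dichotomy for the transposed pair. Should that pair be stable, the eigenvector that the
  -- dichotomy gives for `F`, `H` is a dual eigenvector of it, which is impossible.
  rcases msStable_or_exists_eigenvector Fᵀ Hᵀ with h1 | h1
  · rcases msStable_or_exists_eigenvector F H with h2 | ⟨μ, Z, hμ, hZ, hZ0, hL⟩
    · exact (h h2).elim
    · exact (hZ0 (h1.dual_eigenvector_eq_zero hZ hμ (by simpa using hL))).elim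
  · exact h1

theorem mul_eq_zero_of_trace_conj_le_zero {R : Matrix κ κ ℝ} (hR : R.PosDef) {K : Matrix κ ι ℝ}
    {X : Matrix ι ι ℝ} (hX : X.PosSemidef) (h : (Kᵀ * R * K * X).trace ≤ 0) : K * X = 0 := by
  obtain ⟨r, hr⟩ := hR.posSemidef.exists_transpose_mul_self
  have h1 : (r * K) * X = 0 := mul_eq_zero_of_trace_le_zero hX (by
    rwa [show (r * K)ᵀ * (r * K) = Kᵀ * R * K by
      rw [hr, transpose_mul]; simp only [Matrix.mul_assoc]])
  have h2 : R * (K * X) = 0 := by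
    rw [hr, Matrix.mul_assoc, ← Matrix.mul_assoc r, h1, Matrix.mul_zero]
  have := nonsing_inv_mul_cancel_left R (K * X) ((isUnit_iff_isUnit_det _).1 hR.isUnit)
  rw [← this, h2, Matrix.mul_zero]

/-- A Lyapunov inequality with a detectable right-hand side implies stability: it suffices that a
stable system agrees with the given one wherever the right-hand side vanishes. -/
theorem MSStable.of_detectable {F H F' H' W E : Matrix ι ι ℝ} (h : MSStable F' H')
    (hW : W.PosSemidef) (hL : lyap F H W = -E)
    (hE : ∀ X : Matrix ι ι ℝ, X.PosSemidef → (E * X).trace ≤ 0 → F' * X = F * X ∧ H' * X = H * X) :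
    MSStable F H := by
  by_contra hns
  -- Pairing with `W` gives `-tr (E X) = μ tr (W X) ≥ 0`. Hence `hE` applies to `X`, and `X` is a
  -- dual eigenvector of the stable system too.
  obtain ⟨μ, X, hμ, hX, hX0, hLX⟩ := exists_dual_eigenvector hns
  have h1 : (lyap F H W * X).trace = μ * (W * X).trace := by
    rw [trace_lyap_mul, hLX, Matrix.mul_smul, trace_smul, smul_eq_mul]
  have h2 := mul_nonneg hμ (trace_mul_nonneg hW hX)
  rw [hL, Matrix.neg_mul, trace_neg] at h1
  obtain ⟨hF, hH⟩ := hE X hX (by linarith)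
  have hF' : X * F'ᵀ = X * Fᵀ := by
    simpa [transpose_mul, hX.transpose_eq] using congrArg transpose hF
  have hH' : X * H'ᵀ = X * Hᵀ := by
    simpa [transpose_mul, hX.transpose_eq] using congrArg transpose hH
  refine hX0 (h.dual_eigenvector_eq_zero hX hμ ?_)
  rw [← hLX]
  simp only [lyap_apply, transpose_transpose, hF, hF', hH]
  rw [Matrix.mul_assoc H, hH', Matrix.mul_assoc H]

end LyapunovOperator

/-! ### Complex spectrum, mixed Lyapunov operators and limits of stable systems. -/

section LyapunovSpectrum

attribute [local instance] Matrix.frobeniusNormedSpace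

variable {ι : Type*} [Fintype ι] [DecidableEq ι]

theorem eq_zero_of_quad_eq_zero {U : Matrix ι ι ℝ} (hU : Uᵀ = U) (h : ∀ x, x ⬝ᵥ U *ᵥ x = 0) :
    U = 0 :=
  (posSemidef_iff_real.2 ⟨hU, fun x => (h x).ge⟩).eq_zero_of_neg
    (posSemidef_iff_real.2 ⟨by simp [hU], fun x => by simp [neg_mulVec, h x]⟩)

/-- The real and imaginary parts of an eigenvector of a stable Lyapunov operator show that the
eigenvalue has negative real part. -/
theorem MSStable.re_neg {F H U V : Matrix ι ι ℝ} (h : MSStable F H) (hU : Uᵀ = U) (hV : Vᵀ = V)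
    (h0 : U ≠ 0 ∨ V ≠ 0) {a b : ℝ} (hLU : lyap F H U = a • U - b • V)
    (hLV : lyap F H V = b • U + a • V) : a < 0 := by
  cases isEmpty_or_nonempty ι
  · exact (h0.elim (fun h => h (by ext i; exact isEmptyElim i))
      (fun h => h (by ext i; exact isEmptyElim i))).elim
  obtain ⟨Y, hY, hL⟩ := h
  have hne : (Metric.sphere (0 : ι → ℝ) 1).Nonempty := (NormedSpace.sphere_nonempty).2 zero_le_one
  have hs0 : ∀ x ∈ Metric.sphere (0 : ι → ℝ) 1, x ≠ 0 := by
    rintro x hx rfl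
    simp at hx
  have hq : ∀ M : Matrix ι ι ℝ, Continuous fun x : ι → ℝ => x ⬝ᵥ M *ᵥ x := fun M =>
    continuous_id.dotProduct (continuous_const.matrix_mulVec continuous_id)
  -- Maximize the squared modulus of the complex form `U + iV` relative to `Y`: a complex analogue
  -- of the touching argument for resolvent positivity.
  have hc : ContinuousOn (fun x => ((x ⬝ᵥ U *ᵥ x) ^ 2 + (x ⬝ᵥ V *ᵥ x) ^ 2) / (x ⬝ᵥ Y *ᵥ x) ^ 2)
      (Metric.sphere (0 : ι → ℝ) 1) :=
    (((hq U).pow 2).add ((hq V).pow 2)).continuousOn.div ((hq Y).pow 2).continuousOn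
      fun x hx => pow_ne_zero 2 (hY.quad_pos (hs0 x hx)).ne'
  obtain ⟨x, hx, hmax⟩ := (isCompact_sphere (0 : ι → ℝ) 1).exists_isMaxOn hne hc
  set u := x ⬝ᵥ U *ᵥ x with hu
  set v := x ⬝ᵥ V *ᵥ x with hv
  set y := x ⬝ᵥ Y *ᵥ x with hy
  have hy0 : 0 < y := hY.quad_pos (hs0 x hx)
  have hle : ∀ z : ι → ℝ, (z ⬝ᵥ U *ᵥ z) ^ 2 + (z ⬝ᵥ V *ᵥ z) ^ 2 ≤
      (u ^ 2 + v ^ 2) / y ^ 2 * (z ⬝ᵥ Y *ᵥ z) ^ 2 := by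
    intro z
    rcases eq_or_ne z 0 with rfl | hz
    · simp
    have hnz : ‖z‖ ≠ 0 := by simpa using hz
    have hm := hmax (show (‖z‖⁻¹ • z) ∈ Metric.sphere (0 : ι → ℝ) 1 by simp [norm_smul, hnz])
    simp only [Set.mem_ofPred_eq, mulVec_smul, dotProduct_smul, smul_dotProduct, smul_eq_mul] at hm
    simp only [mul_pow, ← mul_add] at hm
    rw [mul_div_mul_left _ _ (by positivity), mul_div_mul_left _ _ (by positivity),
      div_le_iff₀ (pow_pos (hY.quad_pos hz) 2)] at hm
    exact hm
  have hpos : 0 < u ^ 2 + v ^ 2 := by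
    by_contra hneg
    have h00 : u ^ 2 + v ^ 2 = 0 := le_antisymm (not_lt.1 hneg) (by positivity)
    simp only [h00, zero_div, zero_mul] at hle
    rcases h0 with h0 | h0
    · exact h0 (eq_zero_of_quad_eq_zero hU fun z => by
        nlinarith [hle z, sq_nonneg (z ⬝ᵥ U *ᵥ z), sq_nonneg (z ⬝ᵥ V *ᵥ z)])
    · exact h0 (eq_zero_of_quad_eq_zero hV fun z => by
        nlinarith [hle z, sq_nonneg (z ⬝ᵥ U *ᵥ z), sq_nonneg (z ⬝ᵥ V *ᵥ z)])
  set c := (u ^ 2 + v ^ 2) / y with hcdef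
  have hc0 : 0 < c := by positivity
  have hcy : c * y = u ^ 2 + v ^ 2 := div_mul_cancel₀ _ hy0.ne'
  -- By Cauchy–Schwarz in the plane, with equality at the maximizer `x`. When `lyap F H` is applied
  -- at `x`, the terms in `b` cancel and `a (u² + v²)` remains, to be compared with the negative
  -- form of `lyap F H Y`.
  have hW : (c • Y - (u • U + v • V)).PosSemidef := by
    refine posSemidef_iff_real.2 ⟨by simp [hU, hV, hY.transpose_eq], fun z => ?_⟩
    have h1 := hle z
    have h2 : 0 ≤ z ⬝ᵥ Y *ᵥ z := hY.posSemidef.quad_nonneg z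
    simp only [sub_mulVec, add_mulVec, smul_mulVec, dotProduct_sub, dotProduct_add,
      dotProduct_smul, smul_eq_mul]
    have h3 : (u ^ 2 + v ^ 2) / y ^ 2 * (z ⬝ᵥ Y *ᵥ z) ^ 2 * (u ^ 2 + v ^ 2)
        = (c * (z ⬝ᵥ Y *ᵥ z)) ^ 2 := by
      rw [hcdef]; field_simp
    have h4 : (u * (z ⬝ᵥ U *ᵥ z) + v * (z ⬝ᵥ V *ᵥ z)) ^ 2 ≤ (c * (z ⬝ᵥ Y *ᵥ z)) ^ 2 := by
      rw [← h3]
      nlinarith [sq_nonneg (u * (z ⬝ᵥ V *ᵥ z) - v * (z ⬝ᵥ U *ᵥ z))]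
    linarith [(abs_le_of_sq_le_sq' h4 (by positivity)).2]
  have hW0 : x ⬝ᵥ (c • Y - (u • U + v • V)) *ᵥ x = 0 := by
    simp only [sub_mulVec, add_mulVec, smul_mulVec, dotProduct_sub, dotProduct_add,
      dotProduct_smul, smul_eq_mul, ← hu, ← hv, ← hy]
    linarith
  have h1 := quad_lyap_of_mulVec_eq_zero (F := F) (H := H) hW (hW.mulVec_eq_zero hW0)
  have h2 := hL.quad_pos (hs0 x hx)
  rw [map_sub, map_add, map_smul, map_smul, map_smul, hLU, hLV] at h1
  simp only [sub_mulVec, add_mulVec, smul_mulVec, dotProduct_sub, dotProduct_add, neg_mulVec,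
      dotProduct_neg, dotProduct_smul, smul_eq_mul, ← hu, ← hv] at h1 h2
  by_contra ha
  nlinarith [mul_nonneg (not_lt.1 ha) hpos.le, mul_pos hc0 h2]

/-- An unstable system has a real nonnegative eigenvalue by the dichotomy; for a stable one the real
and imaginary parts of a complex eigenvector are fed to `MSStable.re_neg`. -/
theorem lyapSpectrum_subset_iff {n : ℕ} {F H : Matrix (Fin n) (Fin n) ℝ} :
    lyapSpectrum F H ⊆ {μ : ℂ | μ.re < 0} ↔ MSStable F H := by
  constructor
  · intro h
    rcases msStable_or_exists_eigenvector F H with hs | ⟨μ, Z, hμ, hZ, hZ0, hL⟩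
    · exact hs
    · have hmem : (μ : ℂ) ∈ lyapSpectrum F H := by
        refine ⟨Z.map Complex.ofReal, ?_, ?_, ?_⟩
        · rw [IsSymm, ← transpose_map, hZ.transpose_eq]
        · contrapose! hZ0
          ext i j
          simpa using congrFun₂ hZ0 i j
        · have := congrArg (fun M : Matrix (Fin n) (Fin n) ℝ => M.map Complex.ofRealHom) hL
          simp only [lyap_apply, Matrix.map_add _ (map_add Complex.ofRealHom), Matrix.map_mul,
            transpose_map] at this
          refine this.trans ?_
          ext i j
          simp
      have := h hmem
      simp only [Set.mem_ofPred_eq, Complex.ofReal_re] at this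
      linarith
  · rintro h μ ⟨P, hP, hP0, hL⟩
    have hF : ∀ (F : Matrix (Fin n) (Fin n) ℝ) (P : Matrix (Fin n) (Fin n) ℂ),
        (F.map Complex.ofReal * P).map Complex.re = F * P.map Complex.re ∧
        (F.map Complex.ofReal * P).map Complex.im = F * P.map Complex.im ∧
        (P * F.map Complex.ofReal).map Complex.re = P.map Complex.re * F ∧
        (P * F.map Complex.ofReal).map Complex.im = P.map Complex.im * F := by
      intro F P
      refine ⟨?_, ?_, ?_, ?_⟩ <;> ext i j <;> simp [mul_apply]
    have hre := congrArg (fun M : Matrix (Fin n) (Fin n) ℂ => M.map Complex.re) hL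
    have him := congrArg (fun M : Matrix (Fin n) (Fin n) ℂ => M.map Complex.im) hL
    simp only [genLyap, Matrix.map_add _ Complex.add_re, Matrix.map_add _ Complex.add_im,
      ← transpose_map, hF] at hre him
    have hs1 : (P.map Complex.re)ᵀ = P.map Complex.re := by rw [← transpose_map, hP]
    have hs2 : (P.map Complex.im)ᵀ = P.map Complex.im := by rw [← transpose_map, hP]
    refine h.re_neg (b := μ.im) hs1 hs2 ?_ (hre.trans ?_) (him.trans ?_)
    · by_contra hcon
      push Not at hcon
      refine hP0 ?_
      ext i j
      exact Complex.ext (congrFun₂ hcon.1 i j) (congrFun₂ hcon.2 i j)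
    · ext i j
      simp
    · ext i j
      simp
      ring

theorem MSStable.fromBlocks {F₁ H₁ F₂ H₂ : Matrix ι ι ℝ} (h₁ : MSStable F₁ H₁)
    (h₂ : MSStable F₂ H₂) :
    MSStable (Matrix.fromBlocks F₁ 0 0 F₂) (Matrix.fromBlocks H₁ 0 0 H₂) := by
  obtain ⟨Y₁, hY₁, hL₁⟩ := h₁
  obtain ⟨Y₂, hY₂, hL₂⟩ := h₂
  have key : ∀ {A B : Matrix ι ι ℝ}, A.PosDef → B.PosDef → (Matrix.fromBlocks A 0 0 B).PosDef := by
    intro A B hA hB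
    refine posDef_iff_real.2 ⟨by simp [fromBlocks_transpose, hA.transpose_eq, hB.transpose_eq],
      fun x hx => ?_⟩
    have hx' : x = Sum.elim (x ∘ Sum.inl) (x ∘ Sum.inr) := (Sum.elim_comp_inl_inr x).symm
    rw [fromBlocks_mulVec, hx', sumElim_dotProduct_sumElim]
    simp only [Sum.elim_comp_inl, Sum.elim_comp_inr, zero_mulVec, add_zero, zero_add]
    by_cases hl : x ∘ Sum.inl = 0
    · have hr : x ∘ Sum.inr ≠ 0 := fun hr => hx (by rw [hx', hl, hr]; ext i; cases i <;> rfl)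
      exact add_pos_of_nonneg_of_pos (hA.posSemidef.quad_nonneg _) (hB.quad_pos hr)
    · exact add_pos_of_pos_of_nonneg (hA.quad_pos hl) (hB.posSemidef.quad_nonneg _)
  refine ⟨Matrix.fromBlocks Y₁ 0 0 Y₂, key hY₁ hY₂, ?_⟩
  convert key hL₁ hL₂ using 1
  simp [lyap_apply, fromBlocks_transpose, fromBlocks_multiply, fromBlocks_add, fromBlocks_neg]

/-- Injectivity of the mixed Lyapunov operator of two systems whose growth rates add up to a
negative number. -/
theorem eq_zero_of_mixed_lyap {F₁ H₁ F₂ H₂ X : Matrix ι ι ℝ} {s : ℝ}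
    (h₁ : MSStable (F₁ + s • 1) H₁) (h₂ : MSStable (F₂ - s • 1) H₂)
    (h : F₁ᵀ * X + X * F₂ + H₁ᵀ * X * H₂ = 0) : X = 0 := by
  have ht := congrArg transpose h
  simp only [transpose_add, transpose_mul, transpose_transpose, transpose_zero] at ht
  -- Placed off the diagonal, `X` gives a symmetric null vector of the block diagonal system; the
  -- shifts `s` and `-s` cancel in the off-diagonal blocks.
  have hX := (h₁.fromBlocks h₂).eq_zero (X := Matrix.fromBlocks 0 X Xᵀ 0)
    (by simp [fromBlocks_transpose]) (by
      rw [lyap_apply]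
      simp only [fromBlocks_transpose, fromBlocks_multiply, fromBlocks_add, transpose_zero,
        Matrix.zero_mul, Matrix.mul_zero, add_zero, zero_add]
      rw [← fromBlocks_zero]
      congr 1
      · rw [← h]
        simp only [transpose_add, transpose_smul, transpose_one, Matrix.add_mul, Matrix.mul_sub,
          Matrix.smul_mul, Matrix.mul_smul, Matrix.one_mul, Matrix.mul_one]
        abel
      · rw [← ht]
        simp only [transpose_sub, transpose_smul, transpose_one, Matrix.sub_mul, Matrix.mul_add,
          Matrix.smul_mul, Matrix.mul_smul, Matrix.one_mul, Matrix.mul_one, Matrix.mul_assoc]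
        abel)
  rw [← fromBlocks_zero, fromBlocks_inj] at hX
  exact hX.2.1

/-- A limit of stable systems has arbitrarily small growth rate. -/
theorem exists_msStable_sub_of_tendsto {F H : Matrix ι ι ℝ} {Fs Hs : ℕ → Matrix ι ι ℝ}
    (hF : Tendsto Fs atTop (𝓝 F)) (hH : Tendsto Hs atTop (𝓝 H)) (h : ∀ k, MSStable (Fs k) (Hs k))
    {a : ℝ} (ha : 0 < a) : ∃ s, 0 < s ∧ s < a ∧ MSStable (F - s • 1) H := by
  cases isEmpty_or_nonempty ι
  · exact ⟨a / 2, by linarith, by linarith, MSStable.of_isEmpty _ _⟩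
  -- The spectrum is finite, so some `c` in `(0, 2a)` is not an eigenvalue. For the shift `c / 2`
  -- the singular alternative of `MSStable.of_tendsto` is then excluded.
  obtain ⟨c, hc, hcs⟩ := (Set.Ioo_infinite (show (0 : ℝ) < 2 * a by linarith)).exists_notMem_finite
    (Module.End.finite_spectrum (lyap F H : Module.End ℝ (Matrix ι ι ℝ)))
  refine ⟨c / 2, by linarith [hc.1], by linarith [hc.2], ?_⟩
  rcases MSStable.of_tendsto (hF.sub_const ((c / 2) • (1 : Matrix ι ι ℝ))) hH
    (fun k => (h k).sub_smul_one (by linarith [hc.1])) with hs | ⟨Z, -, ht, hL⟩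
  · exact hs
  · refine (hcs (Module.End.HasEigenvalue.mem_spectrum
      (Module.End.hasEigenvalue_of_hasEigenvector (x := Z) ?_))).elim
    rw [lyap_sub_smul_one, sub_eq_zero, mul_div_cancel₀ _ two_ne_zero] at hL
    refine Module.End.hasEigenvector_iff.2 ⟨Module.End.mem_eigenspace_iff.2 hL, ?_⟩
    rintro rfl
    simp at ht

end LyapunovSpectrum

/-! ### The second moment flow and its positivity. -/

section SecondMoments

attribute [local instance] Matrix.frobeniusNormedSpace

variable {ι : Type*} [Fintype ι] [DecidableEq ι]

theorem HasDerivAt.matrix_linearMap {κ κ' : Type*} [Fintype κ] [Fintype κ']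
    {X : ℝ → Matrix κ κ' ℝ} {X' : Matrix κ κ' ℝ} {t : ℝ} {E : Type*} [NormedAddCommGroup E]
    [NormedSpace ℝ E] (T : Matrix κ κ' ℝ →ₗ[ℝ] E) (h : HasDerivAt X X' t) :
    HasDerivAt (fun s => T (X s)) (T X') t :=
  (LinearMap.toContinuousLinearMap T).hasFDerivAt.comp_hasDerivAt t h

/-- The quadratic form of a matrix at a fixed vector, as a linear map. -/
def quadAt (x : ι → ℝ) : Matrix ι ι ℝ →ₗ[ℝ] ℝ where
  toFun M := x ⬝ᵥ M *ᵥ x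
  map_add' M N := by simp [add_mulVec]
  map_smul' c M := by simp [smul_mulVec]

/-- The flow of a Lyapunov differential equation preserves positive semidefiniteness. -/
theorem posSemidef_of_hasDerivAt {F H : Matrix ι ι ℝ} {X : ℝ → Matrix ι ι ℝ}
    (h0 : (X 0).PosSemidef) (hs : ∀ t, (X t)ᵀ = X t)
    (hX : ∀ t, HasDerivAt X (lyap F H (X t)) t) {t : ℝ} (ht : 0 ≤ t) : (X t).PosSemidef := by
  obtain ⟨s, -, Y, hY, hL⟩ := exists_msStable_sub_smul_one F H
  rw [lyap_sub_smul_one] at hL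
  -- As `lyap F H Y < 2s Y`, the added term makes the differential inequality strict, so a first
  -- exit from the cone can be excluded.
  have main : ∀ ε : ℝ, 0 < ε → ∀ t, 0 ≤ t → (X t + (ε * Real.exp (2 * s * t)) • Y).PosSemidef := by
    intro ε hε
    set W : ℝ → Matrix ι ι ℝ := fun t => X t + (ε * Real.exp (2 * s * t)) • Y with hW
    have hWs : ∀ t, (W t)ᵀ = W t := fun t => by simp [hW, hs, hY.transpose_eq]
    have hWd : ∀ t, HasDerivAt W
        (lyap F H (W t) + (ε * Real.exp (2 * s * t)) • (-(lyap F H Y - (2 * s) • Y))) t := by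
      intro t
      have h1 : HasDerivAt (fun t : ℝ => ε * Real.exp (2 * s * t))
          (ε * (Real.exp (2 * s * t) * (2 * s))) t := by
        have := ((hasDerivAt_id t).const_mul (2 * s)).exp.const_mul ε
        simpa using this
      refine ((hX t).add (h1.smul_const Y)).congr_deriv ?_
      simp only [hW, map_add, map_smul, smul_neg, smul_sub, smul_smul]
      rw [show ε * (Real.exp (2 * s * t) * (2 * s)) = ε * Real.exp (2 * s * t) * (2 * s) by ring]
      abel
    have hWc : Continuous W := continuous_iff_continuousAt.2 fun t => (hWd t).continuousAt
    have hW0 : (W 0).PosDef := PosDef.posSemidef_add h0 (hY.smul (by positivity))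
    by_contra! hcon
    obtain ⟨t₁, ht₁, hnt₁⟩ := hcon
    let B : Set ℝ := {t | 0 ≤ t ∧ ¬ (W t).PosSemidef}
    have hBne : B.Nonempty := ⟨t₁, ht₁, hnt₁⟩
    have hBb : BddBelow B := ⟨0, fun t h => h.1⟩
    set τ := sInf B
    have hτ0 : 0 ≤ τ := le_csInf hBne fun t h => h.1
    have hlt : ∀ t, 0 ≤ t → t < τ → (W t).PosSemidef := by
      intro t ht0 htτ
      by_contra hn
      exact absurd (csInf_le hBb ⟨ht0, hn⟩) (not_le.2 htτ)
    have hnotPD : ¬ (W τ).PosDef := by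
      intro hPD
      have hev := hPD.eventually_posDef (hWc.tendsto τ) hWs
      obtain ⟨δ, hδ, hball⟩ := Metric.eventually_nhds_iff.1 hev
      obtain ⟨t, htB, htlt⟩ := exists_lt_of_csInf_lt hBne (show sInf B < τ + δ by linarith)
      refine htB.2 (hball ?_).posSemidef
      have := csInf_le hBb htB
      rw [Real.dist_eq, abs_lt]
      constructor <;> linarith
    have hτpos : 0 < τ := by
      rcases hτ0.eq_or_lt with h | h
      · exact (hnotPD (h ▸ hW0)).elim
      · exact h
    have hτPSD : (W τ).PosSemidef := by
      have hcl : τ ∈ closure (Set.Ico 0 τ) := by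
        rw [closure_Ico hτpos.ne]
        exact ⟨hτ0, le_rfl⟩
      exact closure_minimal (fun t ht => hlt t ht.1 ht.2)
        (isClosed_posSemidef.preimage hWc) hcl
    have : ∃ x, W τ *ᵥ x = 0 ∧ x ≠ 0 := by
      by_contra! hn
      exact hnotPD (posDef_of_posSemidef_of_ne hτPSD hn)
    obtain ⟨x, hx, hx0⟩ := this
    have hd := (hWd τ).matrix_linearMap (quadAt x)
    have hpos : 0 < quadAt x (lyap F H (W τ) +
        (ε * Real.exp (2 * s * τ)) • (-(lyap F H Y - (2 * s) • Y))) := by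
      rw [map_add, map_smul]
      exact add_pos_of_nonneg_of_pos (quad_lyap_of_mulVec_eq_zero hτPSD hx)
        (mul_pos (by positivity) (hL.quad_pos hx0))
    have hz : quadAt x (W τ) = 0 := by
      change x ⬝ᵥ W τ *ᵥ x = 0
      rw [hx, dotProduct_zero]
    -- At the exit time `τ` the form at the null vector `x` is zero, and it is nonnegative just
    -- before, so its left slopes are at most zero; yet its derivative is positive.
    have hslope := hasDerivAt_iff_tendsto_slope_left_right.1 hd |>.1
    have hge : ∀ᶠ t in 𝓝[<] τ, slope (fun s => quadAt x (W s)) τ t ≤ 0 := by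
      filter_upwards [Ioo_mem_nhdsLT hτpos] with t ht
      rw [slope_def_field, hz, sub_zero]
      exact div_nonpos_of_nonneg_of_nonpos ((hlt t ht.1.le ht.2).quad_nonneg x)
        (by linarith [ht.2])
    exact absurd (le_of_tendsto hslope hge) (not_le.2 hpos)
  refine posSemidef_iff_real.2 ⟨hs t, fun x => ?_⟩
  by_contra! hneg
  have hy := hY.posSemidef.quad_nonneg x
  set q := x ⬝ᵥ Y *ᵥ x
  have he := Real.exp_pos (2 * s * t)
  -- This `ε` makes the added term at most half of the supposed deficit `-(x ⬝ᵥ X t *ᵥ x)`.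
  have := (main (-(x ⬝ᵥ X t *ᵥ x) / (2 * (Real.exp (2 * s * t) * (q + 1))))
    (div_pos (by linarith) (by positivity)) t ht).quad_nonneg x
  simp only [add_mulVec, smul_mulVec, dotProduct_add, dotProduct_smul, smul_eq_mul] at this
  have h2 : -(x ⬝ᵥ X t *ᵥ x) / (2 * (Real.exp (2 * s * t) * (q + 1))) * Real.exp (2 * s * t) * q
      ≤ -(x ⬝ᵥ X t *ᵥ x) / 2 := by
    rw [show -(x ⬝ᵥ X t *ᵥ x) / (2 * (Real.exp (2 * s * t) * (q + 1))) * Real.exp (2 * s * t) * q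
      = -(x ⬝ᵥ X t *ᵥ x) / 2 * (q / (q + 1)) by field_simp]
    exact mul_le_of_le_one_right (by linarith) ((div_le_one (by positivity)).2 (by linarith))
  linarith

/-- The flow of a linear differential equation. -/
theorem exists_linear_flow {E : Type*} [NormedAddCommGroup E] [NormedSpace ℝ E]
    [FiniteDimensional ℝ E] (T : E →ₗ[ℝ] E) :
    ∃ Φ : ℝ → E →ₗ[ℝ] E, (∀ x, Φ 0 x = x) ∧
      (∀ x t, HasDerivAt (fun s => Φ s x) (T (Φ t x)) t) ∧
      ∀ (x : E) (μ : ℝ), T x = μ • x → ∀ t, Φ t x = Real.exp (μ * t) • x := by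
  have : CompleteSpace E := FiniteDimensional.complete ℝ _
  set A : E →L[ℝ] E := LinearMap.toContinuousLinearMap T
  have h0 : ∀ x, NormedSpace.exp ((0 : ℝ) • A) x = x := by simp
  refine ⟨fun t => (NormedSpace.exp (t • A) : E →L[ℝ] E).toLinearMap, h0, fun x t => ?_,
    fun x μ hx t => ?_⟩
  · exact ((hasDerivAt_exp_smul_const' (𝕂 := ℝ) A t).clm_apply (hasDerivAt_const t x)).congr_deriv
      (by simp [A])
  · have hd : ∀ t, HasDerivAt
        (fun s => Real.exp (-(μ * s)) • (NormedSpace.exp (s • A) : E →L[ℝ] E) x) 0 t := by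
      intro t
      have h1 : HasDerivAt (fun s : ℝ => (NormedSpace.exp (s • A) : E →L[ℝ] E) x)
          (μ • (NormedSpace.exp (t • A) : E →L[ℝ] E) x) t :=
        ((hasDerivAt_exp_smul_const (𝕂 := ℝ) A t).clm_apply (hasDerivAt_const t x)).congr_deriv
          (by simp [A, hx])
      have h2 : HasDerivAt (fun s : ℝ => Real.exp (-(μ * s))) (Real.exp (-(μ * t)) * (-μ)) t := by
        have := ((hasDerivAt_id t).const_mul μ).neg.exp
        simpa using this
      refine (h2.smul h1).congr_deriv ?_
      rw [smul_smul, ← add_smul]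
      simp
    have hc := is_const_of_deriv_eq_zero (fun t => (hd t).differentiableAt)
      (fun t => (hd t).deriv) t 0
    simp only [mul_zero, neg_zero, Real.exp_zero, one_smul, h0] at hc
    change (NormedSpace.exp (t • A) : E →L[ℝ] E) x = _
    nth_rw 2 [← hc]
    rw [smul_smul, ← Real.exp_add]
    simp

/-- Second moments with positive semidefinite initial values exist, are positive semidefinite and
depend linearly on the initial value. -/
theorem exists_secondMoment_flow (F H : Matrix ι ι ℝ) :
    ∃ Φ : ℝ → Matrix ι ι ℝ →ₗ[ℝ] Matrix ι ι ℝ, (∀ X, Xᵀ = X → Φ 0 X = X) ∧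
      (∀ X t, HasDerivAt (fun s => Φ s X) (lyap F H (Φ t X)) t) ∧
      (∀ (X : Matrix ι ι ℝ) (μ : ℝ), Xᵀ = X → lyap F H X = μ • X →
        ∀ t, Φ t X = Real.exp (μ * t) • X) ∧
      ∀ (X : Matrix ι ι ℝ), X.PosSemidef → ∀ t, 0 ≤ t → (Φ t X).PosSemidef := by
  obtain ⟨Φ, h0, hd, he⟩ := exists_linear_flow (lyap F H)
  let τ : Matrix ι ι ℝ →ₗ[ℝ] Matrix ι ι ℝ := (transposeLinearEquiv ι ι ℝ ℝ).toLinearMap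
  have hτ : ∀ M, τ M = Mᵀ := fun M => rfl
  have hhalf : ∀ M : Matrix ι ι ℝ, (1 / 2 : ℝ) • (M + M) = M := fun M => by
    rw [← two_smul ℝ M, smul_smul]
    norm_num
  -- Symmetrizing the exponential flow, which is allowed because `lyap` commutes with transposition,
  -- gives symmetric values at all times without a uniqueness argument.
  let Ψ : ℝ → Matrix ι ι ℝ →ₗ[ℝ] Matrix ι ι ℝ := fun t => (1 / 2 : ℝ) • (Φ t + τ ∘ₗ Φ t)
  have hΨ : ∀ t X, Ψ t X = (1 / 2 : ℝ) • (Φ t X + (Φ t X)ᵀ) := fun t X => rfl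
  have hΨ0 : ∀ X, Xᵀ = X → Ψ 0 X = X := fun X hX => by rw [hΨ, h0, hX, hhalf]
  have hΨd : ∀ X t, HasDerivAt (fun s => Ψ s X) (lyap F H (Ψ t X)) t := by
    intro X t
    have h1 := ((hd X t).add ((hd X t).matrix_linearMap τ)).const_smul (1 / 2 : ℝ)
    refine h1.congr_deriv ?_
    rw [hΨ, map_smul, map_add, hτ, lyap_transpose]
  refine ⟨Ψ, hΨ0, hΨd, fun X μ hX hL t => ?_, fun X hX t ht => ?_⟩
  · rw [hΨ, he X μ hL, transpose_smul, hX, hhalf]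
  · refine posSemidef_of_hasDerivAt (X := fun s => Ψ s X) ?_ (fun s => ?_) (hΨd X) ht
    · rw [hΨ0 X hX.transpose_eq]
      exact hX
    · simp only [hΨ, transpose_smul, transpose_add, transpose_transpose]
      rw [add_comm]

end SecondMoments

/-! ### Exact detectability in terms of dual eigenvectors. -/

section Detectability

attribute [local instance] Matrix.frobeniusNormedSpace

variable {n m₁ m₂ : ℕ}

theorem isSecondMoment_of_hasDerivAt {F H : Matrix (Fin n) (Fin n) ℝ} {x₀ : Fin n → ℝ}
    {X : ℝ → Matrix (Fin n) (Fin n) ℝ} (h0 : X 0 = vecMulVec x₀ x₀)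
    (hX : ∀ t, HasDerivAt X (lyap Fᵀ Hᵀ (X t)) t) : IsSecondMoment F H x₀ X := by
  refine ⟨h0, fun t _ i j => ?_⟩
  have := ((hX t).matrix_linearMap (entryLinearMap ℝ ℝ i j)).hasDerivWithinAt
    (s := Set.Ici 0)
  simpa [lyap_apply] using this

/-- Split `X` into rank-one pieces, each the initial second moment of a deterministic state. Their
flows add up to `exp (μ t) • X`, which `Q` annihilates; the outputs are nonnegative, so each one
vanishes. Detectability sends every trace to zero, although their sum stays at least `tr X`. -/
theorem RobustLQ.ExactlyDetectable.eq_zero_of_dual_eigenvector {S : RobustLQ n m₁ m₂}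
    (hdet : S.ExactlyDetectable) {X : Matrix (Fin n) (Fin n) ℝ} (hX : X.PosSemidef) {μ : ℝ}
    (hμ : 0 ≤ μ) (hL : lyap S.Aᵀ S.Cᵀ X = μ • X) (hQ : S.Q * X = 0) : X = 0 := by
  obtain ⟨Φ, h0, hd, he, hp⟩ := exists_secondMoment_flow S.Aᵀ S.Cᵀ
  obtain ⟨N, hN⟩ := hX.exists_transpose_mul_self
  have hvp : ∀ i, (vecMulVec (N i) (N i)).PosSemidef := fun i => by
    simpa using posSemidef_vecMulVec_self_star (N i)
  have hsum : X = ∑ i, vecMulVec (N i) (N i) := by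
    rw [hN]
    ext j k
    simp [mul_apply, Matrix.sum_apply, vecMulVec_apply]
  have hsumΦ : ∀ t, ∑ i, Φ t (vecMulVec (N i) (N i)) = Real.exp (μ * t) • X := fun t => by
    rw [← map_sum, ← hsum, he X μ hX.transpose_eq hL]
  have hlim : ∀ i, Tendsto (fun t => (Φ t (vecMulVec (N i) (N i))).trace) atTop (𝓝 0) := by
    intro i
    refine hdet (N i) (fun t => Φ t (vecMulVec (N i) (N i)))
      (isSecondMoment_of_hasDerivAt (h0 _ (hvp i).transpose_eq) (hd _)) fun t ht => ?_
    have hnn : ∀ j, 0 ≤ (S.Q * Φ t (vecMulVec (N j) (N j)) * S.Qᵀ).trace := fun j => by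
      simpa using ((hp _ (hvp j) t ht).transpose_conj S.Qᵀ).trace_nonneg
    have hz : ∑ j, (S.Q * Φ t (vecMulVec (N j) (N j)) * S.Qᵀ).trace = 0 := by
      rw [← trace_sum, ← Finset.sum_mul, ← Finset.mul_sum, hsumΦ, Matrix.mul_smul, hQ]
      simp
    exact (Finset.sum_eq_zero_iff_of_nonneg fun j _ => hnn j).1 hz i (Finset.mem_univ i)
  have hlim' := tendsto_finsetSum Finset.univ fun i _ => hlim i
  simp only [← trace_sum, hsumΦ, Finset.sum_const_zero, trace_smul, smul_eq_mul] at hlim'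
  refine hX.eq_zero_of_trace (ge_of_tendsto hlim' ?_)
  filter_upwards [eventually_ge_atTop 0] with t ht
  exact le_mul_of_one_le_left hX.trace_nonneg (Real.one_le_exp (mul_nonneg hμ ht))

/-- Exact detectability turns a Lyapunov inequality for the cost into stability. -/
theorem RobustLQ.ExactlyDetectable.msStable {S : RobustLQ n m₁ m₂} (hdet : S.ExactlyDetectable)
    (hQ : S.Q.PosSemidef) (hR : S.R.PosDef) {K : Matrix (Fin m₁) (Fin n) ℝ}
    {W E : Matrix (Fin n) (Fin n) ℝ} (hW : W.PosSemidef)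
    (hE : (E - (S.Q + Kᵀ * S.R * K)).PosSemidef)
    (hL : lyap (S.A - S.B * K) (S.C - S.D * K) W = -E) :
    MSStable (S.A - S.B * K) (S.C - S.D * K) := by
  by_contra hns
  -- A growing mode `X` has `tr (E X) ≤ 0`, hence `Q X = 0` and `K X = 0`. The feedback is then
  -- invisible on `X`, which becomes a dual eigenvector of the uncontrolled system.
  obtain ⟨μ, X, hμ, hX, hX0, hLX⟩ := exists_dual_eigenvector hns
  have h1 : (lyap (S.A - S.B * K) (S.C - S.D * K) W * X).trace = μ * (W * X).trace := by
    rw [trace_lyap_mul, hLX, Matrix.mul_smul, trace_smul, smul_eq_mul]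
  have h2 := mul_nonneg hμ (trace_mul_nonneg hW hX)
  have h3 := trace_mul_nonneg hE hX
  have h4 := trace_mul_nonneg hQ hX
  have h5 := trace_mul_nonneg (hR.posSemidef.transpose_conj K) hX
  rw [hL, Matrix.neg_mul, trace_neg] at h1
  rw [Matrix.sub_mul, trace_sub, Matrix.add_mul, trace_add] at h3
  obtain ⟨q, hq⟩ := hQ.exists_transpose_mul_self
  have hQX : S.Q * X = 0 := by
    have : q * X = 0 := mul_eq_zero_of_trace_le_zero hX (by rw [← hq]; linarith)
    rw [hq, Matrix.mul_assoc, this, Matrix.mul_zero]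
  have hKX : K * X = 0 := mul_eq_zero_of_trace_conj_le_zero hR hX (by linarith)
  have hXK : X * Kᵀ = 0 := by
    have := congrArg transpose hKX
    rwa [transpose_mul, hX.transpose_eq, transpose_zero] at this
  refine hX0 (hdet.eq_zero_of_dual_eigenvector hX hμ ?_ hQX)
  rw [← hLX]
  simp only [lyap_apply, transpose_transpose, transpose_sub, transpose_mul, Matrix.sub_mul,
    Matrix.mul_sub, Matrix.mul_assoc, hKX, Matrix.mul_zero, sub_zero]
  simp only [← Matrix.mul_assoc, hXK, Matrix.zero_mul, sub_zero]
  simp [Matrix.mul_assoc]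

end Detectability

/-! ### Riccati residual, completion of squares, uniqueness and continuity. -/

section Riccati

attribute [local instance] Matrix.frobeniusNormedSpace

theorem Filter.Tendsto.matrix_mul {α ι κ ν : Type*} [Fintype ι] [Fintype κ] [Fintype ν]
    {l : Filter α} {u : α → Matrix ι κ ℝ} {v : α → Matrix κ ν ℝ} {a : Matrix ι κ ℝ}
    {b : Matrix κ ν ℝ} (hu : Tendsto u l (𝓝 a)) (hv : Tendsto v l (𝓝 b)) :
    Tendsto (fun k => u k * v k) l (𝓝 (a * b)) :=
  ((continuous_fst.matrix_mul continuous_snd).tendsto (a, b)).comp (hu.prodMk_nhds hv)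

theorem Filter.Tendsto.matrix_transpose {α ι κ : Type*} [Fintype ι] [Fintype κ]
    {l : Filter α} {u : α → Matrix ι κ ℝ} {a : Matrix ι κ ℝ} (hu : Tendsto u l (𝓝 a)) :
    Tendsto (fun k => (u k)ᵀ) l (𝓝 aᵀ) :=
  (continuous_id.matrix_transpose.tendsto a).comp hu

namespace RobustLQ

variable {n m₁ m₂ : ℕ} {S : RobustLQ n m₁ m₂} {K : Matrix (Fin m₁) (Fin n) ℝ}
  {L : Matrix (Fin m₂) (Fin n) ℝ} {P : Matrix (Fin n) (Fin n) ℝ}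

/-- The residual of the Lyapunov equation for the cost of the pair of gains `K`, `L`. -/
def residual (S : RobustLQ n m₁ m₂) (K : Matrix (Fin m₁) (Fin n) ℝ) (L : Matrix (Fin m₂) (Fin n) ℝ)
    (P : Matrix (Fin n) (Fin n) ℝ) : Matrix (Fin n) (Fin n) ℝ :=
  S.lyapOp K L P + (S.Q - S.γ ^ 2 • (Lᵀ * L)) + Kᵀ * S.R * K

/-- Stability of the closed loop with the gains `K`, `L`. -/
def Stable (S : RobustLQ n m₁ m₂) (K : Matrix (Fin m₁) (Fin n) ℝ)
    (L : Matrix (Fin m₂) (Fin n) ℝ) : Prop :=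
  MSStable (S.drift K L) (S.diffusion K)

theorem lyapOp_eq (S : RobustLQ n m₁ m₂) (K : Matrix (Fin m₁) (Fin n) ℝ)
    (L : Matrix (Fin m₂) (Fin n) ℝ) (P : Matrix (Fin n) (Fin n) ℝ) :
    S.lyapOp K L P = lyap (S.drift K L) (S.diffusion K) P := rfl

theorem isOuterSolution_iff : S.IsOuterSolution L P ↔ Pᵀ = P ∧ (S.R + S.Dᵀ * P * S.D).PosDef ∧
    S.residual (S.gainK P) L P = 0 ∧ S.Stable (S.gainK P) L := by
  rw [IsOuterSolution, SpectrallyStable, lyapSpectrum_subset_iff]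
  rfl

theorem residual_sub (S : RobustLQ n m₁ m₂) (K : Matrix (Fin m₁) (Fin n) ℝ)
    (L : Matrix (Fin m₂) (Fin n) ℝ) (P P' : Matrix (Fin n) (Fin n) ℝ) :
    S.residual K L P - S.residual K L P' = lyap (S.drift K L) (S.diffusion K) (P - P') := by
  rw [map_sub, ← lyapOp_eq, ← lyapOp_eq, residual, residual]
  abel

theorem residual_transpose (hQ : S.Qᵀ = S.Q) (hR : S.Rᵀ = S.R) (hP : Pᵀ = P) :
    (S.residual K L P)ᵀ = S.residual K L P := by
  simp only [residual, lyapOp_eq, transpose_add, transpose_sub, transpose_smul, transpose_mul,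
    transpose_transpose, hQ, hR, lyap_transpose_eq hP, Matrix.mul_assoc]

theorem weight_mul_gainK (hW : (S.R + S.Dᵀ * P * S.D).PosDef) :
    (S.R + S.Dᵀ * P * S.D) * S.gainK P = S.Bᵀ * P + S.Dᵀ * P * S.C :=
  mul_nonsing_inv_cancel_left _ _ ((isUnit_iff_isUnit_det _).1 hW.isUnit)

theorem residual_expand (S : RobustLQ n m₁ m₂) (K : Matrix (Fin m₁) (Fin n) ℝ)
    (L : Matrix (Fin m₂) (Fin n) ℝ) (P : Matrix (Fin n) (Fin n) ℝ) :
    S.residual K L P = lyap (S.A + S.G * L) S.C P + (S.Q - S.γ ^ 2 • (Lᵀ * L))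
      - Kᵀ * (S.Bᵀ * P + S.Dᵀ * P * S.C) - (P * S.B + S.Cᵀ * P * S.D) * K
      + Kᵀ * (S.R + S.Dᵀ * P * S.D) * K := by
  simp only [residual, lyapOp_eq, lyap_apply, drift, diffusion, transpose_sub, transpose_add,
    transpose_mul, Matrix.mul_add, Matrix.add_mul, Matrix.mul_sub, Matrix.sub_mul,
    Matrix.mul_assoc]
  abel

theorem transpose_weight_mul_gainK (hR : S.Rᵀ = S.R) (hP : Pᵀ = P)
    (hW : (S.R + S.Dᵀ * P * S.D).PosDef) :
    (S.gainK P)ᵀ * (S.R + S.Dᵀ * P * S.D) = P * S.B + S.Cᵀ * P * S.D := by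
  have := congrArg transpose (weight_mul_gainK hW)
  simpa only [transpose_add, transpose_mul, transpose_transpose, hR, hP, ← Matrix.mul_assoc]
    using this

/-- Completion of squares in the control gain. -/
theorem residual_eq_gainK_add (hR : S.Rᵀ = S.R) (hP : Pᵀ = P)
    (hW : (S.R + S.Dᵀ * P * S.D).PosDef) (K : Matrix (Fin m₁) (Fin n) ℝ)
    (L : Matrix (Fin m₂) (Fin n) ℝ) :
    S.residual K L P = S.residual (S.gainK P) L P +
      (K - S.gainK P)ᵀ * (S.R + S.Dᵀ * P * S.D) * (K - S.gainK P) := by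
  rw [residual_expand, residual_expand, ← weight_mul_gainK hW,
    ← transpose_weight_mul_gainK hR hP hW]
  simp only [transpose_sub, Matrix.mul_sub, Matrix.sub_mul, Matrix.mul_assoc]
  abel

/-- Completion of squares in the disturbance gain. -/
theorem residual_eq_gainL_sub (hγ : 0 < S.γ) (hP : Pᵀ = P) (K : Matrix (Fin m₁) (Fin n) ℝ)
    (L : Matrix (Fin m₂) (Fin n) ℝ) :
    S.residual K L P = S.residual K (S.gainL P) P -
      S.γ ^ 2 • ((L - S.gainL P)ᵀ * (L - S.gainL P)) := by
  have h1 : S.Gᵀ * P = S.γ ^ 2 • S.gainL P := by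
    rw [gainL, smul_smul, mul_one_div_cancel (by positivity), one_smul]
  have h2 : P * S.G = S.γ ^ 2 • (S.gainL P)ᵀ := by
    simpa [transpose_mul, hP] using congrArg transpose h1
  have key : ∀ L : Matrix (Fin m₂) (Fin n) ℝ, lyap (S.A + S.G * L) S.C P =
      lyap S.A S.C P + S.γ ^ 2 • (Lᵀ * S.gainL P) + S.γ ^ 2 • ((S.gainL P)ᵀ * L) := by
    intro L
    rw [← Matrix.mul_smul, ← h1, ← Matrix.smul_mul, ← h2]
    simp only [lyap_apply, transpose_add, transpose_mul, Matrix.mul_add, Matrix.add_mul,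
      Matrix.mul_assoc]
    abel
  rw [residual_expand, residual_expand, key, key]
  simp only [transpose_sub, Matrix.mul_sub, Matrix.sub_mul, smul_sub]
  abel

/-- `Pstar` is a fixed point of the outer step. The sign of the quadratic term in `G` comes out
right because the drift contributes it twice and the cost subtracts it once. -/
theorem isStabilizingSARE_iff (hR : S.R.PosDef) (hγ : 0 < S.γ) :
    S.IsStabilizingSARE P ↔ P.PosSemidef ∧ S.IsOuterSolution (S.gainL P) P := by
  rw [isOuterSolution_iff, IsStabilizingSARE, SpectrallyStable, lyapSpectrum_subset_iff]
  refine and_congr_right fun hP => ?_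
  have hW : (S.R + S.Dᵀ * P * S.D).PosDef := hR.add_posSemidef (hP.transpose_conj S.D)
  have h1 : S.residual (S.gainK P) (S.gainL P) P =
      S.Aᵀ * P + P * S.A + S.Cᵀ * P * S.C + S.Q + (1 / S.γ ^ 2) • (P * S.G * S.Gᵀ * P)
      - (P * S.B + S.Cᵀ * P * S.D) * (S.R + S.Dᵀ * P * S.D)⁻¹ * (S.Bᵀ * P + S.Dᵀ * P * S.C) := by
    have h2 : S.γ ^ 2 • ((S.gainL P)ᵀ * S.gainL P) = (1 / S.γ ^ 2) • (P * S.G * S.Gᵀ * P) := by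
      simp only [gainL, transpose_smul, transpose_mul, transpose_transpose, hP.transpose_eq,
        Matrix.smul_mul, Matrix.mul_smul, smul_smul, Matrix.mul_assoc]
      congr 1
      field_simp
    have h3 : lyap (S.A + S.G * S.gainL P) S.C P =
        lyap S.A S.C P + (1 / S.γ ^ 2) • (P * S.G * S.Gᵀ * P)
          + (1 / S.γ ^ 2) • (P * S.G * S.Gᵀ * P) := by
      simp only [lyap_apply, gainL, transpose_add, transpose_smul, transpose_mul,
        transpose_transpose, hP.transpose_eq, Matrix.smul_mul, Matrix.mul_smul, Matrix.mul_assoc,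
        Matrix.add_mul, Matrix.mul_add]
      abel
    have h4 : S.residual (S.gainK P) (S.gainL P) P = _ := residual_expand _ _ _ _
    rw [h4, h2, h3, ← weight_mul_gainK hW, ← transpose_weight_mul_gainK hR.transpose_eq
      hP.transpose_eq hW, lyap_apply]
    rw [mul_nonsing_inv_cancel_right _ _ ((isUnit_iff_isUnit_det _).1 hW.isUnit)]
    simp only [Matrix.mul_assoc]
    abel
  rw [h1]
  exact ⟨fun h => ⟨hP.transpose_eq, hW, h⟩, fun h => h.2.2⟩

/-- The residual of `P'` at the gain of `P` is a square, so the stable loop of `P` forces `P ≥ P'`.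
Exchanging the roles gives uniqueness. -/
theorem IsOuterSolution.sub_posSemidef {P' : Matrix (Fin n) (Fin n) ℝ} (hR : S.Rᵀ = S.R)
    (h : S.IsOuterSolution L P) (h' : S.IsOuterSolution L P') : (P - P').PosSemidef := by
  rw [isOuterSolution_iff] at h h'
  obtain ⟨hs, -, hr, hst⟩ := h
  obtain ⟨hs', hW', hr', -⟩ := h'
  rw [← neg_sub]
  refine hst.neg_posSemidef (by simp [hs, hs']) ?_
  rw [← residual_sub, hr, residual_eq_gainK_add hR hs' hW', hr', zero_add, sub_zero]
  exact hW'.posSemidef.transpose_conj _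

theorem IsOuterSolution.unique {P' : Matrix (Fin n) (Fin n) ℝ} (hR : S.Rᵀ = S.R)
    (h : S.IsOuterSolution L P) (h' : S.IsOuterSolution L P') : P = P' :=
  sub_eq_zero.1 ((h.sub_posSemidef hR h').eq_zero_of_neg (by
    rw [neg_sub]; exact h'.sub_posSemidef hR h))

theorem weight_posDef_of_le {W : Matrix (Fin n) (Fin n) ℝ} (hW : (S.R + S.Dᵀ * W * S.D).PosDef)
    (h : (P - W).PosSemidef) : (S.R + S.Dᵀ * P * S.D).PosDef := by
  have := hW.add_posSemidef (h.transpose_conj S.D)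
  rwa [Matrix.mul_sub, Matrix.sub_mul, add_assoc, add_sub_cancel] at this

theorem tendsto_weight_inv {α : Type*} {l : Filter α} {Ps : α → Matrix (Fin n) (Fin n) ℝ}
    (hP : (S.R + S.Dᵀ * P * S.D).PosDef) (h : Tendsto Ps l (𝓝 P)) :
    Tendsto (fun a => (S.R + S.Dᵀ * Ps a * S.D)⁻¹) l (𝓝 (S.R + S.Dᵀ * P * S.D)⁻¹) :=
  Tendsto.comp (continuousAt_matrix_inv _ (by
    rw [Ring.inverse_eq_inv']
    exact continuousAt_inv₀ ((isUnit_iff_isUnit_det _).1 hP.isUnit).ne_zero))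
    (tendsto_const_nhds.add ((tendsto_const_nhds.matrix_mul h).matrix_mul tendsto_const_nhds))

theorem continuousAt_gainK (hW : (S.R + S.Dᵀ * P * S.D).PosDef) : ContinuousAt S.gainK P := by
  have h3 := tendsto_weight_inv hW tendsto_id
  have h4 : Continuous fun P : Matrix (Fin n) (Fin n) ℝ => S.Bᵀ * P + S.Dᵀ * P * S.C :=
    (continuous_const.matrix_mul continuous_id).add
      ((continuous_const.matrix_mul continuous_id).matrix_mul continuous_const)
  exact h3.matrix_mul (h4.tendsto P)

theorem tendsto_residual {α : Type*} {l : Filter α} {Ks : α → Matrix (Fin m₁) (Fin n) ℝ}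
    {Ls : α → Matrix (Fin m₂) (Fin n) ℝ} {Ps : α → Matrix (Fin n) (Fin n) ℝ}
    (hK : Tendsto Ks l (𝓝 K)) (hL : Tendsto Ls l (𝓝 L)) (hP : Tendsto Ps l (𝓝 P)) :
    Tendsto (fun a => S.residual (Ks a) (Ls a) (Ps a)) l (𝓝 (S.residual K L P)) := by
  have hF : Tendsto (fun a => S.drift (Ks a) (Ls a)) l (𝓝 (S.drift K L)) :=
    (tendsto_const_nhds.sub (tendsto_const_nhds.matrix_mul hK)).add
      (tendsto_const_nhds.matrix_mul hL)
  have hH : Tendsto (fun a => S.diffusion (Ks a)) l (𝓝 (S.diffusion K)) :=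
    tendsto_const_nhds.sub (tendsto_const_nhds.matrix_mul hK)
  have h1 := (hF.matrix_transpose.matrix_mul hP).add (hP.matrix_mul hF)
  have h2 := (hH.matrix_transpose.matrix_mul hP).matrix_mul hH
  have h3 := (tendsto_const_nhds (x := S.Q)).sub
    ((hL.matrix_transpose.matrix_mul hL).const_smul (S.γ ^ 2))
  have h4 := (hK.matrix_transpose.matrix_mul (tendsto_const_nhds (x := S.R))).matrix_mul hK
  exact ((h1.add h2).add h3).add h4

end RobustLQ

end Riccati

/-! ### Existence between sub- and supersolutions, and continuity in the disturbance gain. -/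

section RiccatiExistence

attribute [local instance] Matrix.frobeniusNormedSpace

namespace RobustLQ

variable {n m₁ m₂ : ℕ} {S : RobustLQ n m₁ m₂} {K : Matrix (Fin m₁) (Fin n) ℝ}
  {L : Matrix (Fin m₂) (Fin n) ℝ} {P : Matrix (Fin n) (Fin n) ℝ}

theorem isCompact_posSemidef_Icc (W V : Matrix (Fin n) (Fin n) ℝ) :
    IsCompact {P : Matrix (Fin n) (Fin n) ℝ | (P - W).PosSemidef ∧ (V - P).PosSemidef} := by
  have : ProperSpace (Matrix (Fin n) (Fin n) ℝ) := FiniteDimensional.proper ℝ _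
  refine (isCompact_closedBall W (V - W).trace).of_isClosed_subset
    ((isClosed_posSemidef.preimage (by fun_prop)).inter
      (isClosed_posSemidef.preimage (by fun_prop))) ?_
  rintro P ⟨h1, h2⟩
  rw [Metric.mem_closedBall, dist_eq_norm]
  refine h1.norm_le_trace.trans ?_
  have := h2.trace_nonneg
  simp only [trace_sub] at this ⊢
  linarith

/-- Between a detectable subsolution and a supersolution of the Riccati equation there is a
stabilizing solution: a supersolution of minimal trace. -/
theorem exists_isOuterSolution (hQ : S.Qᵀ = S.Q) (hR : S.Rᵀ = S.R)
    {W V : Matrix (Fin n) (Fin n) ℝ} (hWs : Wᵀ = W) (hWV : (V - W).PosSemidef)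
    (hWR : (S.R + S.Dᵀ * W * S.D).PosDef) (hW : (S.residual (S.gainK W) L W).PosSemidef)
    (hV : (-(S.residual (S.gainK V) L V)).PosSemidef)
    (hst : ∀ P, (P - W).PosSemidef → (-(S.residual (S.gainK P) L P)).PosSemidef →
      S.Stable (S.gainK P) L) :
    ∃ P, S.IsOuterSolution L P ∧ (P - W).PosSemidef ∧ (V - P).PosSemidef := by
  have hsymm : ∀ P : Matrix (Fin n) (Fin n) ℝ, (P - W).PosSemidef → Pᵀ = P := fun P hP => by
    have := hP.transpose_eq
    rwa [transpose_sub, hWs, sub_left_inj] at this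
  have hco : ContinuousOn (fun P => -(S.residual (S.gainK P) L P))
      {P | (P - W).PosSemidef ∧ (V - P).PosSemidef} := fun P hP =>
    (tendsto_residual (continuousAt_gainK (weight_posDef_of_le hWR hP.1)) tendsto_const_nhds
      tendsto_id).neg.mono_left nhdsWithin_le_nhds
  have hcomp := (isCompact_posSemidef_Icc W V).of_isClosed_subset
    (hco.preimage_isClosed_of_isClosed (isCompact_posSemidef_Icc W V).isClosed isClosed_posSemidef)
    Set.inter_subset_left
  obtain ⟨P, ⟨⟨hPW, hVP⟩, hPr⟩, hmin⟩ := hcomp.exists_isMinOn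
    ⟨V, ⟨hWV, by rw [sub_self]; exact PosSemidef.zero⟩, hV⟩
    (continuous_id.matrix_trace (R := ℝ)).continuousOn
  replace hPr : (-(S.residual (S.gainK P) L P)).PosSemidef := hPr
  have hPs := hsymm P hPW
  have hstP := hst P hPW hPr
  -- A Newton–Kleinman step: `P - Z` is the cost of the gain of `P`. It is again a supersolution in
  -- the interval and lies below `P`, so minimality of the trace forces `Z = 0`.
  obtain ⟨Z, hZ, hLZ⟩ := hstP.exists_lyap_eq
    (residual_transpose (K := S.gainK P) (L := L) hQ hR hPs)
  have hres : S.residual (S.gainK P) L (P - Z) = 0 := by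
    have := residual_sub S (S.gainK P) L P (P - Z)
    rwa [sub_sub_cancel, hLZ, sub_eq_self] at this
  have hZp : Z.PosSemidef := hstP.posSemidef hZ (by rwa [hLZ])
  have hZW : (P - Z - W).PosSemidef := by
    refine hstP.posSemidef (by simp [hPs, hZ, hWs]) ?_
    rw [← residual_sub, hres, zero_sub, neg_neg, residual_eq_gainK_add hR hWs hWR]
    exact hW.add (hWR.posSemidef.transpose_conj _)
  have hmem : P - Z ∈ {P | (P - W).PosSemidef ∧ (V - P).PosSemidef} ∩
      (fun P => -(S.residual (S.gainK P) L P)) ⁻¹' {M | M.PosSemidef} := by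
    refine ⟨⟨hZW, ?_⟩, ?_⟩
    · rw [← sub_add]
      exact hVP.add hZp
    · have hw := weight_posDef_of_le hWR hZW
      have := residual_eq_gainK_add hR (hsymm _ hZW) hw (S.gainK P) L
      rw [hres] at this
      change (-(S.residual (S.gainK (P - Z)) L (P - Z))).PosSemidef
      rw [neg_eq_of_add_eq_zero_right this.symm]
      exact hw.posSemidef.transpose_conj _
  have htr := hmin hmem
  have hZ0 : Z = 0 := hZp.eq_zero_of_trace (by
    simp only [Set.mem_ofPred_eq, id, trace_sub] at htr
    linarith)
  refine ⟨P, isOuterSolution_iff.2 ⟨hPs, weight_posDef_of_le hWR hPW, ?_, hstP⟩, hPW, hVP⟩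
  rw [← hLZ, hZ0, map_zero]

/-- This makes `P - W` a candidate Lyapunov function: the right-hand side collects the supersolution
defect of `P`, the subsolution excess of `W` and the gain mismatch. -/
theorem residual_sub_eq_neg (hR : S.Rᵀ = S.R) {W : Matrix (Fin n) (Fin n) ℝ} (hWs : Wᵀ = W)
    (hWR : (S.R + S.Dᵀ * W * S.D).PosDef) (K : Matrix (Fin m₁) (Fin n) ℝ)
    (L : Matrix (Fin m₂) (Fin n) ℝ) (P : Matrix (Fin n) (Fin n) ℝ) :
    lyap (S.drift K L) (S.diffusion K) (P - W) =
      -(-(S.residual K L P) + S.residual (S.gainK W) L W +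
        (K - S.gainK W)ᵀ * (S.R + S.Dᵀ * W * S.D) * (K - S.gainK W)) := by
  rw [← residual_sub, residual_eq_gainK_add hR hWs hWR]
  abel

theorem stable_of_strict_subsolution (hR : S.Rᵀ = S.R) {W : Matrix (Fin n) (Fin n) ℝ}
    (hWs : Wᵀ = W) (hWR : (S.R + S.Dᵀ * W * S.D).PosDef)
    (hW : (S.residual (S.gainK W) L W).PosDef) (hPW : (P - W).PosSemidef)
    (hP : (-(S.residual (S.gainK P) L P)).PosSemidef) : S.Stable (S.gainK P) L :=
  .of_posSemidef_of_posDef hPW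
    ((hW.posSemidef_add hP).add_posSemidef (hWR.posSemidef.transpose_conj _))
    (residual_sub_eq_neg hR hWs hWR _ _ _)

theorem gainK_sub {P' : Matrix (Fin n) (Fin n) ℝ} (hW : (S.R + S.Dᵀ * P * S.D).PosDef)
    (hW' : (S.R + S.Dᵀ * P' * S.D).PosDef) :
    S.gainK P' - S.gainK P = (S.R + S.Dᵀ * P' * S.D)⁻¹ *
      (S.Bᵀ * (P' - P) + S.Dᵀ * (P' - P) * (S.C - S.D * S.gainK P)) := by
  have hu := (isUnit_iff_isUnit_det _).1 hW'.isUnit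
  have h1 : (S.R + S.Dᵀ * P' * S.D) * (S.gainK P' - S.gainK P) =
      S.Bᵀ * (P' - P) + S.Dᵀ * (P' - P) * (S.C - S.D * S.gainK P) := by
    rw [Matrix.mul_sub, weight_mul_gainK hW']
    have h2 : (S.R + S.Dᵀ * P' * S.D) * S.gainK P =
        (S.R + S.Dᵀ * P * S.D) * S.gainK P + S.Dᵀ * (P' - P) * S.D * S.gainK P := by
      simp only [Matrix.add_mul, Matrix.mul_sub, Matrix.sub_mul]
      abel
    rw [h2, weight_mul_gainK hW]
    simp only [Matrix.mul_sub, Matrix.sub_mul, Matrix.mul_assoc]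
    abel
  rw [← nonsing_inv_mul_cancel_left _ (S.gainK P' - S.gainK P) hu, h1]

theorem weight_transpose (hR : S.Rᵀ = S.R) (hP : Pᵀ = P) :
    (S.R + S.Dᵀ * P * S.D)ᵀ = S.R + S.Dᵀ * P * S.D := by
  rw [transpose_add, hR, transpose_mul, transpose_mul, hP, transpose_transpose, Matrix.mul_assoc]

/-- The correction from changing the gain is of second order in `P' - P`, which is what makes the
perturbation and Newton estimates work. -/
theorem gainK_sub_quad {P' : Matrix (Fin n) (Fin n) ℝ} (hR : S.Rᵀ = S.R) (hP' : P'ᵀ = P')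
    (hW : (S.R + S.Dᵀ * P * S.D).PosDef) (hW' : (S.R + S.Dᵀ * P' * S.D).PosDef) :
    (S.gainK P - S.gainK P')ᵀ * (S.R + S.Dᵀ * P' * S.D) * (S.gainK P - S.gainK P') =
      (S.Bᵀ * (P' - P) + S.Dᵀ * (P' - P) * (S.C - S.D * S.gainK P))ᵀ *
        (S.R + S.Dᵀ * P' * S.D)⁻¹ *
        (S.Bᵀ * (P' - P) + S.Dᵀ * (P' - P) * (S.C - S.D * S.gainK P)) := by
  rw [← neg_sub, gainK_sub hW hW']
  set T := S.Bᵀ * (P' - P) + S.Dᵀ * (P' - P) * (S.C - S.D * S.gainK P)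
  rw [transpose_neg, transpose_mul, transpose_nonsing_inv, weight_transpose hR hP',
    Matrix.neg_mul, Matrix.neg_mul, Matrix.mul_neg, neg_neg,
    nonsing_inv_mul_cancel_right _ _ ((isUnit_iff_isUnit_det _).1 hW'.isUnit), Matrix.mul_assoc Tᵀ]

/-- The stabilizing solution exists for all disturbance gains near a given one and depends
continuously on the gain. -/
theorem IsOuterSolution.exists_near (hQ : S.Qᵀ = S.Q) (hR : S.Rᵀ = S.R)
    (h : S.IsOuterSolution L P) {η : ℝ} (hη : 0 < η) :
    ∃ ε : ℝ, 0 < ε ∧ ∀ L', ‖L' - L‖ < ε → ∃ P', S.IsOuterSolution L' P' ∧ ‖P' - P‖ < η := by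
  obtain ⟨hPs, hPR, hPr, hPst⟩ := isOuterSolution_iff.1 h
  -- `N` is the direction in which the linearized residual equals `-1`. For small `t > 0`, `P + t •
  -- N` is a strict supersolution and `P - t • N` a strict subsolution.
  obtain ⟨N, hN, hLN⟩ := hPst.exists_lyap_eq (E := -1) (by simp)
  have hNp : N.PosSemidef := hPst.posSemidef hN (by rw [hLN, neg_neg]; exact PosSemidef.one)
  set T := S.Bᵀ * N + S.Dᵀ * N * (S.C - S.D * S.gainK P) with hT
  have hsymm : ∀ t : ℝ, (P + t • N)ᵀ = P + t • N := fun t => by simp [hPs, hN]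
  have hlim : Tendsto (fun t : ℝ => P + t • N) (𝓝 0) (𝓝 P) := by
    have : Continuous fun t : ℝ => P + t • N := by fun_prop
    simpa using this.tendsto 0
  have hlimR : Tendsto (fun t : ℝ => S.R + S.Dᵀ * (P + t • N) * S.D) (𝓝 0)
      (𝓝 (S.R + S.Dᵀ * P * S.D)) :=
    tendsto_const_nhds.add ((tendsto_const_nhds.matrix_mul hlim).matrix_mul tendsto_const_nhds)
  have hRs : ∀ t : ℝ, (S.R + S.Dᵀ * (P + t • N) * S.D)ᵀ = S.R + S.Dᵀ * (P + t • N) * S.D :=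
    fun t => weight_transpose hR (hsymm t)
  have hev1 : ∀ᶠ t in 𝓝 (0 : ℝ), (S.R + S.Dᵀ * (P + t • N) * S.D).PosDef :=
    hPR.eventually_posDef hlimR hRs
  have hlimI := tendsto_weight_inv hPR hlim
  have hlimE : Tendsto (fun t : ℝ => (1 : Matrix (Fin n) (Fin n) ℝ) +
      t • (Tᵀ * (S.R + S.Dᵀ * (P + t • N) * S.D)⁻¹ * T)) (𝓝 0) (𝓝 1) := by
    have := (tendsto_const_nhds (x := (1 : Matrix (Fin n) (Fin n) ℝ))).add
      ((tendsto_id (α := ℝ) (x := 𝓝 0)).smul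
      ((tendsto_const_nhds (x := Tᵀ)).matrix_mul hlimI |>.matrix_mul
        (tendsto_const_nhds (x := T))))
    simpa using this
  have hev2 : ∀ᶠ t in 𝓝 (0 : ℝ), ((1 : Matrix (Fin n) (Fin n) ℝ) +
      t • (Tᵀ * (S.R + S.Dᵀ * (P + t • N) * S.D)⁻¹ * T)).PosDef := by
    refine PosDef.one.eventually_posDef hlimE fun t => ?_
    rw [transpose_add, transpose_smul, transpose_mul, transpose_mul, transpose_transpose,
      transpose_nonsing_inv, hRs, transpose_one, Matrix.mul_assoc Tᵀ]
  have hric : ∀ t : ℝ, (S.R + S.Dᵀ * (P + t • N) * S.D).PosDef →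
      S.residual (S.gainK (P + t • N)) L (P + t • N) =
        -(t • ((1 : Matrix (Fin n) (Fin n) ℝ) +
          t • (Tᵀ * (S.R + S.Dᵀ * (P + t • N) * S.D)⁻¹ * T))) := by
    intro t ht
    have h1 := residual_sub S (S.gainK P) L (P + t • N) P
    rw [hPr, sub_zero, add_sub_cancel_left, map_smul, hLN,
      residual_eq_gainK_add hR (hsymm t) ht] at h1
    have h2 : (S.gainK P - S.gainK (P + t • N))ᵀ * (S.R + S.Dᵀ * (P + t • N) * S.D) *
        (S.gainK P - S.gainK (P + t • N)) =
        t • t • (Tᵀ * (S.R + S.Dᵀ * (P + t • N) * S.D)⁻¹ * T) := by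
      have h3 : S.Bᵀ * (t • N) + S.Dᵀ * (t • N) * (S.C - S.D * S.gainK P) = t • T := by
        simp only [hT, Matrix.mul_smul, Matrix.smul_mul, smul_add]
      rw [gainK_sub_quad hR (hsymm t) hPR ht, add_sub_cancel_left, h3]
      simp only [transpose_smul, Matrix.smul_mul, Matrix.mul_smul]
    rw [h2] at h1
    rw [eq_sub_of_add_eq h1]
    simp only [smul_add, smul_neg]
    abel
  have hev := hev1.and hev2
  obtain ⟨r, hr, hball⟩ := Metric.eventually_nhds_iff.1 hev
  have htr := hNp.trace_nonneg
  -- The final distance is at most `3 t tr N`: the width `2 t tr N` of the interval plus the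
  -- distance `t tr N` from `P` to its lower end.
  set t := min (r / 2) (η / (6 * (N.trace + 1))) with ht
  have ht0 : 0 < t := lt_min (by linarith) (by positivity)
  have htr' : t < r := (min_le_left _ _).trans_lt (by linarith)
  have htη : 3 * t * N.trace < η := by
    have h1 : t ≤ η / (6 * (N.trace + 1)) := min_le_right _ _
    rw [le_div_iff₀ (by positivity)] at h1
    nlinarith
  obtain ⟨hVR, hV⟩ := hball (y := t) (by simpa [abs_of_pos ht0] using htr')
  obtain ⟨hWR, hW⟩ := hball (y := -t) (by simpa [abs_of_pos ht0] using htr')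
  have hVric : (-(S.residual (S.gainK (P + t • N)) L (P + t • N))).PosDef := by
    rw [hric t hVR, neg_neg]
    exact hV.smul ht0
  have hWric : (S.residual (S.gainK (P + (-t) • N)) L (P + (-t) • N)).PosDef := by
    rw [hric (-t) hWR, neg_smul (-t |> fun _ => t), neg_neg]
    exact hW.smul ht0
  -- Strict inequalities survive a small change of the disturbance gain, so the same two barriers
  -- enclose a solution for `L'`.
  have hnear : ∀ M : Matrix (Fin n) (Fin n) ℝ, Tendsto
      (fun L' => S.residual (S.gainK M) L' M) (𝓝 L) (𝓝 (S.residual (S.gainK M) L M)) := fun M =>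
    tendsto_residual tendsto_const_nhds tendsto_id tendsto_const_nhds
  have hfin := (hVric.eventually_posDef (hnear (P + t • N)).neg fun L' => by
      rw [transpose_neg, residual_transpose hQ hR (hsymm t)]).and
    (hWric.eventually_posDef (hnear (P + (-t) • N)) fun L' =>
      residual_transpose hQ hR (hsymm (-t)))
  obtain ⟨ε, hε, hεb⟩ := Metric.eventually_nhds_iff.1 hfin
  refine ⟨ε, hε, fun L' hL' => ?_⟩
  obtain ⟨h1, h2⟩ := hεb (y := L') (by rwa [dist_eq_norm])
  have hVW : P + t • N - (P + (-t) • N) = (2 * t) • N := by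
    rw [add_sub_add_left_eq_sub, ← sub_smul]
    congr 1
    ring
  obtain ⟨P', hP', hP'W, hVP'⟩ := exists_isOuterSolution hQ hR (hsymm (-t))
    (V := P + t • N) (by rw [hVW]; exact hNp.smul (by linarith)) hWR h2.posSemidef h1.posSemidef
    fun M hM hMr => stable_of_strict_subsolution hR (hsymm (-t)) hWR h2 hM hMr
  refine ⟨P', hP', lt_of_le_of_lt ?_ htη⟩
  have e1 : ‖P' - (P + (-t) • N)‖ ≤ 2 * t * N.trace := by
    refine hP'W.norm_le_trace.trans ?_
    have e2 := hVP'.trace_nonneg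
    have e3 := congrArg trace hVW
    simp only [trace_sub, trace_smul, smul_eq_mul] at e2 e3 ⊢
    linarith
  have e2 : ‖(-t) • N‖ ≤ t * N.trace := by
    rw [norm_smul, norm_neg, Real.norm_of_nonneg ht0.le]
    exact mul_le_mul_of_nonneg_left hNp.norm_le_trace ht0.le
  calc ‖P' - P‖ = ‖(P' - (P + (-t) • N)) + (-t) • N‖ := by congr 1; abel
    _ ≤ _ := norm_add_le _ _
    _ ≤ _ := by linarith

end RobustLQ

end RiccatiExistence

/-! ### The undisturbed outer loop and its convergence. -/

section ExactIteration

attribute [local instance] Matrix.frobeniusNormedSpace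

namespace RobustLQ

variable {n m₁ m₂ : ℕ} {S : RobustLQ n m₁ m₂} {K : Matrix (Fin m₁) (Fin n) ℝ}
  {L : Matrix (Fin m₂) (Fin n) ℝ} {P : Matrix (Fin n) (Fin n) ℝ}

theorem gainL_zero (S : RobustLQ n m₁ m₂) : S.gainL 0 = 0 := by simp [gainL]

theorem gainL_sub (S : RobustLQ n m₁ m₂) (P P' : Matrix (Fin n) (Fin n) ℝ) :
    S.gainL P - S.gainL P' = S.gainL (P - P') := by
  simp only [gainL, Matrix.mul_sub, smul_sub]

theorem norm_gainL_le (S : RobustLQ n m₁ m₂) (P : Matrix (Fin n) (Fin n) ℝ) :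
    ‖S.gainL P‖ ≤ ‖S.G‖ / S.γ ^ 2 * ‖P‖ := by
  rw [gainL, norm_smul, Real.norm_of_nonneg (by positivity)]
  calc 1 / S.γ ^ 2 * ‖S.Gᵀ * P‖ ≤ 1 / S.γ ^ 2 * (‖S.Gᵀ‖ * ‖P‖) := by
        gcongr
        exact frobenius_norm_mul _ _
    _ = _ := by rw [frobenius_norm_transpose]; ring

theorem tendsto_gainL {α : Type*} {l : Filter α} {Ps : α → Matrix (Fin n) (Fin n) ℝ}
    (h : Tendsto Ps l (𝓝 P)) : Tendsto (fun a => S.gainL (Ps a)) l (𝓝 (S.gainL P)) :=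
  (tendsto_const_nhds.matrix_mul h).const_smul _

/-- `W` is a subsolution of the Riccati equation with the disturbance gain of `W`, all
supersolutions above `W` are stabilizing. -/
def IsDetectableSubsolution (S : RobustLQ n m₁ m₂) (W : Matrix (Fin n) (Fin n) ℝ) : Prop :=
  W.PosSemidef ∧ (S.residual (S.gainK W) (S.gainL W) W).PosSemidef ∧
    ∀ P, (P - W).PosSemidef → (-(S.residual (S.gainK P) (S.gainL W) P)).PosSemidef →
      S.Stable (S.gainK P) (S.gainL W)

/-- Start of the induction, where exact detectability enters: both gains of `0` vanish, the residual
is `Q`, and a supersolution `P ≥ 0` bounds the cost `Q + Kᵀ R K`. -/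
theorem isDetectableSubsolution_zero (hQ : S.Q.PosSemidef) (hR : S.R.PosDef)
    (hdet : S.ExactlyDetectable) : S.IsDetectableSubsolution 0 := by
  have hK0 : S.gainK 0 = 0 := by simp [gainK]
  refine ⟨PosSemidef.zero, ?_, fun P hP hr => ?_⟩
  · rw [gainL_zero, hK0]
    simpa [residual, lyapOp_eq] using hQ
  · rw [gainL_zero] at hr ⊢
    have hd : S.drift (S.gainK P) 0 = S.A - S.B * S.gainK P := by simp [drift]
    rw [Stable, hd]
    rw [sub_zero] at hP
    refine hdet.msStable hQ hR hP (E := -(S.residual (S.gainK P) 0 P) +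
      (S.Q + (S.gainK P)ᵀ * S.R * S.gainK P)) (by rwa [add_sub_cancel_right]) ?_
    rw [residual, lyapOp_eq, hd, diffusion]
    simp only [Matrix.mul_zero, smul_zero, sub_zero]
    abel

/-- Passing to the gain of `P` leaves the residual `γ² (L - gainL P)ᵀ (L - gainL P)`. On a second
moment where this and the control mismatch vanish, the new loop agrees with the stable loop of `P`,
so detectability is inherited. -/
theorem IsOuterSolution.isDetectableSubsolution (hR : S.Rᵀ = S.R) (hγ : 0 < S.γ)
    (h : S.IsOuterSolution L P) (hP : P.PosSemidef) : S.IsDetectableSubsolution P := by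
  obtain ⟨hPs, hPR, hPr, hPst⟩ := isOuterSolution_iff.1 h
  have hres : S.residual (S.gainK P) (S.gainL P) P =
      S.γ ^ 2 • ((L - S.gainL P)ᵀ * (L - S.gainL P)) := by
    rw [residual_eq_gainL_sub hγ hPs] at hPr
    exact sub_eq_zero.1 hPr
  have hsq : (S.γ ^ 2 • ((L - S.gainL P)ᵀ * (L - S.gainL P))).PosSemidef :=
    (posSemidef_transpose_mul_self _).smul (by positivity)
  refine ⟨hP, by rwa [hres], fun V hV hVr => ?_⟩
  refine MSStable.of_detectable hPst hV (residual_sub_eq_neg hR hPs hPR _ _ _) fun X hX hE => ?_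
  rw [Matrix.add_mul, Matrix.add_mul, trace_add, trace_add, hres] at hE
  have h1 := trace_mul_nonneg hVr hX
  have h2 := trace_mul_nonneg hsq hX
  have h3 := trace_mul_nonneg (hPR.posSemidef.transpose_conj (S.gainK V - S.gainK P)) hX
  have hKX := mul_eq_zero_of_trace_conj_le_zero hPR hX (K := S.gainK V - S.gainK P) (by linarith)
  have hLX : (L - S.gainL P) * X = 0 := by
    refine mul_eq_zero_of_trace_le_zero hX ?_
    have h4 : S.γ ^ 2 * ((L - S.gainL P)ᵀ * (L - S.gainL P) * X).trace ≤ 0 := by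
      rw [← smul_eq_mul, ← trace_smul, ← Matrix.smul_mul]
      linarith
    have h5 : 0 < S.γ ^ 2 := by positivity
    by_contra hcon
    nlinarith
  rw [Matrix.sub_mul, sub_eq_zero] at hKX hLX
  constructor
  · simp only [drift, Matrix.add_mul, Matrix.sub_mul, Matrix.mul_assoc, hKX, hLX]
  · simp only [diffusion, Matrix.sub_mul, Matrix.mul_assoc, hKX]

/-- `Pstar` is the upper barrier: completing the square in the disturbance gain makes its residual
at `gainL W` nonpositive. -/
theorem IsDetectableSubsolution.exists_step (hQ : S.Qᵀ = S.Q) (hR : S.R.PosDef) (hγ : 0 < S.γ)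
    {W Pstar : Matrix (Fin n) (Fin n) ℝ} (hW : S.IsDetectableSubsolution W)
    (hle : (Pstar - W).PosSemidef) (hstar : S.IsOuterSolution (S.gainL Pstar) Pstar) :
    ∃ P, S.IsOuterSolution (S.gainL W) P ∧ (P - W).PosSemidef ∧ (Pstar - P).PosSemidef ∧
      S.IsDetectableSubsolution P := by
  obtain ⟨hWp, hWr, hWst⟩ := hW
  obtain ⟨hs, -, hr, -⟩ := isOuterSolution_iff.1 hstar
  obtain ⟨P, hP, hPW, hVP⟩ := exists_isOuterSolution hQ hR.transpose_eq hWp.transpose_eq hle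
    (hR.add_posSemidef (hWp.transpose_conj _)) hWr (by
      rw [residual_eq_gainL_sub hγ hs, hr, zero_sub, neg_neg]
      exact (posSemidef_transpose_mul_self _).smul (by positivity)) hWst
  exact ⟨P, hP, hPW, hVP, hP.isDetectableSubsolution hR.transpose_eq hγ (by
    simpa using hPW.add hWp)⟩

/-- The exact outer loop, started from `0`, increases and stays below the stabilizing solution. -/
theorem exists_exact_iteration (hQ : S.Q.PosSemidef) (hR : S.R.PosDef) (hγ : 0 < S.γ)
    (hdet : S.ExactlyDetectable) {Pstar : Matrix (Fin n) (Fin n) ℝ} (hp : Pstar.PosSemidef)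
    (hstar : S.IsOuterSolution (S.gainL Pstar) Pstar) :
    ∃ P : ℕ → Matrix (Fin n) (Fin n) ℝ, P 0 = 0 ∧
      (∀ k, S.IsOuterSolution (S.gainL (P k)) (P (k + 1))) ∧
      (∀ k, (P (k + 1) - P k).PosSemidef) ∧ ∀ k, (Pstar - P k).PosSemidef := by
  let T := {W : Matrix (Fin n) (Fin n) ℝ // S.IsDetectableSubsolution W ∧ (Pstar - W).PosSemidef}
  have hstep : ∀ W : T, ∃ P : T, S.IsOuterSolution (S.gainL W.1) P.1 ∧ (P.1 - W.1).PosSemidef :=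
    fun W => by
      obtain ⟨P, h1, h2, h3, h4⟩ := W.2.1.exists_step hQ.transpose_eq hR hγ W.2.2 hstar
      exact ⟨⟨P, h4, h3⟩, h1, h2⟩
  choose f hf1 hf2 using hstep
  let s : ℕ → T := fun k => Nat.rec
    ⟨0, isDetectableSubsolution_zero hQ hR hdet, by rwa [sub_zero]⟩ (fun _ W => f W) k
  exact ⟨fun k => (s k).1, rfl, fun k => hf1 (s k), fun k => hf2 (s k), fun k => (s k).2.2⟩

/-- The cross terms of the Riccati equation in one of two pairs of gains. -/
theorem cross_residual (hR : S.Rᵀ = S.R) (hγ : 0 < S.γ) (hP : Pᵀ = P)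
    (hW : (S.R + S.Dᵀ * P * S.D).PosDef) (K : Matrix (Fin m₁) (Fin n) ℝ)
    (L : Matrix (Fin m₂) (Fin n) ℝ) :
    (S.drift (S.gainK P) (S.gainL P))ᵀ * P + P * S.drift K L +
        (S.diffusion (S.gainK P))ᵀ * P * S.diffusion K =
      S.residual (S.gainK P) (S.gainL P) P - S.Q + S.γ ^ 2 • ((S.gainL P)ᵀ * L) -
        (S.gainK P)ᵀ * S.R * K := by
  have h1 : P * S.G = S.γ ^ 2 • (S.gainL P)ᵀ := by
    rw [gainL, transpose_smul, smul_smul, mul_one_div_cancel (by positivity), one_smul]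
    simp [transpose_mul, hP]
  have h2 : P * S.B + (S.diffusion (S.gainK P))ᵀ * P * S.D = (S.gainK P)ᵀ * S.R := by
    have h3 := transpose_weight_mul_gainK hR hP hW
    rw [Matrix.mul_add] at h3
    rw [eq_sub_of_add_eq h3, diffusion]
    simp only [transpose_sub, transpose_mul, Matrix.sub_mul, Matrix.mul_assoc]
    abel
  have h4 : ∀ L : Matrix (Fin m₂) (Fin n) ℝ, P * (S.G * L) = S.γ ^ 2 • ((S.gainL P)ᵀ * L) :=
    fun L => by rw [← Matrix.mul_assoc, h1, Matrix.smul_mul]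
  have h5 : ∀ K : Matrix (Fin m₁) (Fin n) ℝ, (S.diffusion (S.gainK P))ᵀ * (P * (S.D * K)) =
      (S.gainK P)ᵀ * (S.R * K) - P * (S.B * K) := fun K => by
    have := congrArg (· * K) h2
    simp only [Matrix.add_mul, Matrix.mul_assoc] at this
    rw [← this]
    abel
  have hd : S.drift K L = S.drift (S.gainK P) (S.gainL P) + (S.B * S.gainK P - S.B * K) +
      (S.G * L - S.G * S.gainL P) := by
    simp only [drift]
    abel
  have hc : S.diffusion K = S.diffusion (S.gainK P) + (S.D * S.gainK P - S.D * K) := by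
    simp only [diffusion]
    abel
  rw [residual, lyapOp_eq, lyap_apply, hd, hc]
  simp only [Matrix.mul_add, Matrix.mul_sub, Matrix.mul_assoc, h4, h5]
  abel

/-- The difference of two solutions of the Riccati equation is annihilated by the mixed Lyapunov
operator of the two closed loops. -/
theorem mixed_lyap_sub_eq_zero {P' : Matrix (Fin n) (Fin n) ℝ} (hQ : S.Qᵀ = S.Q) (hR : S.Rᵀ = S.R)
    (hγ : 0 < S.γ) (hP : Pᵀ = P) (hP' : P'ᵀ = P') (hW : (S.R + S.Dᵀ * P * S.D).PosDef)
    (hW' : (S.R + S.Dᵀ * P' * S.D).PosDef)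
    (hr : S.residual (S.gainK P) (S.gainL P) P = 0)
    (hr' : S.residual (S.gainK P') (S.gainL P') P' = 0) :
    (S.drift (S.gainK P) (S.gainL P))ᵀ * (P - P') +
      (P - P') * S.drift (S.gainK P') (S.gainL P') +
      (S.diffusion (S.gainK P))ᵀ * (P - P') * S.diffusion (S.gainK P') = 0 := by
  have h1 := cross_residual hR hγ hP hW (S.gainK P') (S.gainL P')
  have h2 := congrArg transpose (cross_residual hR hγ hP' hW' (S.gainK P) (S.gainL P))
  rw [hr] at h1
  rw [hr'] at h2
  simp only [transpose_add, transpose_sub, transpose_smul, transpose_mul, transpose_transpose, hP',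
    hQ, hR, transpose_zero] at h2
  simp only [Matrix.mul_sub, Matrix.sub_mul]
  rw [show ∀ a b c d e f : Matrix (Fin n) (Fin n) ℝ, a - b + (c - d) + (e - f) =
    (a + c + e) - (d + b + f) from fun a b c d e f => by abel, h1, Matrix.mul_assoc _ P', h2]
  simp only [Matrix.mul_assoc]
  abel

/-- Bounded monotone traces make the sequence Cauchy, and the limit (called `Q` in the proof, not
the weight `S.Q`) solves the Riccati equation. What remains is to identify it with `Pstar` although
its loop may be only marginally stable. -/
theorem tendsto_exact_iteration (hQ : S.Q.PosSemidef) (hR : S.R.PosDef) (hγ : 0 < S.γ)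
    {Pstar : Matrix (Fin n) (Fin n) ℝ}
    (hstar : S.IsOuterSolution (S.gainL Pstar) Pstar) {P : ℕ → Matrix (Fin n) (Fin n) ℝ}
    (h0 : P 0 = 0) (hP : ∀ k, S.IsOuterSolution (S.gainL (P k)) (P (k + 1)))
    (hmono : ∀ k, (P (k + 1) - P k).PosSemidef) (hle : ∀ k, (Pstar - P k).PosSemidef) :
    Tendsto P atTop (𝓝 Pstar) := by
  have : CompleteSpace (Matrix (Fin n) (Fin n) ℝ) := FiniteDimensional.complete ℝ _
  have hmono' : ∀ j k, j ≤ k → (P k - P j).PosSemidef := by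
    intro j k hjk
    induction k, hjk using Nat.le_induction with
    | base => rw [sub_self]; exact PosSemidef.zero
    | succ k _ ih => simpa using (hmono k).add ih
  have htr : Tendsto (fun k => (P k).trace) atTop (𝓝 (⨆ k, (P k).trace)) := by
    refine tendsto_atTop_ciSup (fun j k hjk => ?_) ⟨Pstar.trace, ?_⟩
    · simpa using (hmono' j k hjk).trace_nonneg
    · rintro _ ⟨k, rfl⟩
      simpa using (hle k).trace_nonneg
  have hcau : CauchySeq P := by
    refine Metric.cauchySeq_iff'.2 fun ε hε => ?_
    obtain ⟨N, hN⟩ := Metric.cauchySeq_iff'.1 htr.cauchySeq ε hε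
    refine ⟨N, fun k hk => lt_of_le_of_lt ?_ (hN k hk)⟩
    rw [dist_eq_norm, Real.dist_eq, ← trace_sub]
    exact (hmono' N k hk).norm_le_trace.trans (le_abs_self _)
  obtain ⟨Q, hQlim⟩ := cauchySeq_tendsto_of_complete hcau
  have hpos : ∀ k, (P k).PosSemidef := fun k => by simpa [h0] using hmono' 0 k (Nat.zero_le k)
  have hQp : Q.PosSemidef := isClosed_posSemidef.mem_of_tendsto hQlim (Eventually.of_forall hpos)
  have hQR : (S.R + S.Dᵀ * Q * S.D).PosDef := hR.add_posSemidef (hQp.transpose_conj _)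
  have hlim1 : Tendsto (fun k => P (k + 1)) atTop (𝓝 Q) := hQlim.comp (tendsto_add_atTop_nat 1)
  have hK : Tendsto (fun k => S.gainK (P (k + 1))) atTop (𝓝 (S.gainK Q)) :=
    (continuousAt_gainK hQR).tendsto.comp hlim1
  have hL := tendsto_gainL (S := S) hQlim
  have hres : S.residual (S.gainK Q) (S.gainL Q) Q = 0 := by
    refine tendsto_nhds_unique (tendsto_residual hK hL hlim1) ?_
    simp only [(isOuterSolution_iff.1 (hP _)).2.2.1]
    exact tendsto_const_nhds
  obtain ⟨hs, hsR, hsr, hst⟩ := isOuterSolution_iff.1 hstar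
  obtain ⟨t, ht, hadd⟩ := hst.exists_add_smul_one
  have hF : Tendsto (fun k => S.drift (S.gainK (P (k + 1))) (S.gainL (P k))) atTop
      (𝓝 (S.drift (S.gainK Q) (S.gainL Q))) :=
    (tendsto_const_nhds.sub (tendsto_const_nhds.matrix_mul hK)).add
      (tendsto_const_nhds.matrix_mul hL)
  have hH : Tendsto (fun k => S.diffusion (S.gainK (P (k + 1)))) atTop
      (𝓝 (S.diffusion (S.gainK Q))) :=
    tendsto_const_nhds.sub (tendsto_const_nhds.matrix_mul hK)
  -- The margin `t` of the loop of `Pstar` pays for the growth rate `s < t` of the limit loop.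
  obtain ⟨s, hs0, hst', hsub⟩ := exists_msStable_sub_of_tendsto hF hH
    (fun k => (isOuterSolution_iff.1 (hP k)).2.2.2) ht
  have hz := eq_zero_of_mixed_lyap (hadd s hst') hsub
    (mixed_lyap_sub_eq_zero hQ.transpose_eq hR.transpose_eq hγ hs hQp.transpose_eq hsR hQR hsr hres)
  rwa [sub_eq_zero.1 hz]

theorem norm_lt_of_sub_posSemidef {X D : Matrix (Fin n) (Fin n) ℝ} (hX : X.PosSemidef)
    (hD : D.PosSemidef) (h0 : D ≠ 0) : ‖X‖ < ‖X + D‖ := by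
  have h1 : 0 < ‖D‖ := norm_pos_iff.2 h0
  have h2 := trace_mul_nonneg hX hD
  have h3 := frobenius_norm_sq X
  have h4 := frobenius_norm_sq D
  have h5 := frobenius_norm_sq (X + D)
  rw [transpose_add, Matrix.add_mul, Matrix.mul_add, Matrix.mul_add, trace_add, trace_add,
    trace_add, hX.transpose_eq, hD.transpose_eq, trace_mul_comm D X] at h5
  rw [hX.transpose_eq] at h3
  rw [hD.transpose_eq] at h4
  exact lt_of_pow_lt_pow_left₀ 2 (norm_nonneg _) (by nlinarith)

/-- The error of the exact outer loop is strictly below its first value, unless the first step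
already hits the stabilizing solution. -/
theorem exact_iteration_norm_lt (hR : S.Rᵀ = S.R) {Pstar : Matrix (Fin n) (Fin n) ℝ}
    {P : ℕ → Matrix (Fin n) (Fin n) ℝ}
    (hP : ∀ k, S.IsOuterSolution (S.gainL (P k)) (P (k + 1)))
    (hmono : ∀ k, (P (k + 1) - P k).PosSemidef) (hle : ∀ k, (Pstar - P k).PosSemidef)
    (hlim : Tendsto P atTop (𝓝 Pstar)) (hne : P 1 ≠ Pstar) {k : ℕ} (hk : 1 ≤ k) :
    ‖Pstar - P (k + 1)‖ < ‖Pstar - P 1‖ := by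
  have hmono' : ∀ j k, j ≤ k → (P k - P j).PosSemidef := by
    intro j k hjk
    induction k, hjk using Nat.le_induction with
    | base => rw [sub_self]; exact PosSemidef.zero
    | succ k _ ih => simpa using (hmono k).add ih
  -- A return to `P 1` squeezes `P 2 = P 1`. By uniqueness the sequence is then constant from index
  -- `1`, and its limit would be `P 1`.
  have hD : P (k + 1) - P 1 ≠ 0 := by
    intro h
    have h12 : P 2 = P 1 := by
      refine sub_eq_zero.1 ((hmono 1).eq_zero_of_neg ?_)
      rw [neg_sub, ← sub_eq_zero.1 h]
      exact hmono' 2 (k + 1) (by omega)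
    have hall : ∀ j, P (j + 1) = P 1 := by
      intro j
      induction j with
      | zero => rfl
      | succ j ih =>
        have h2 := hP (j + 1)
        rw [ih] at h2
        rw [← h12]
        exact h2.unique hR (hP 1)
    refine hne (tendsto_nhds_unique ?_ (hlim.comp (tendsto_add_atTop_nat 1)))
    simp only [Function.comp_def, hall]
    exact tendsto_const_nhds
  have := norm_lt_of_sub_posSemidef (hle (k + 1)) (hmono' 1 (k + 1) (by omega)) hD
  rwa [sub_add_sub_cancel] at this

end RobustLQ

end ExactIteration

/-! ### Local quadratic convergence and the disturbed loop. -/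

section InexactIteration

attribute [local instance] Matrix.frobeniusNormedSpace

namespace RobustLQ

variable {n m₁ m₂ : ℕ} {S : RobustLQ n m₁ m₂} {L : Matrix (Fin m₂) (Fin n) ℝ}
  {P : Matrix (Fin n) (Fin n) ℝ}

theorem norm_gain_increment_le (S : RobustLQ n m₁ m₂) (N M : Matrix (Fin n) (Fin n) ℝ) :
    ‖S.Bᵀ * N + S.Dᵀ * N * M‖ ≤ (‖S.B‖ + ‖S.D‖ * ‖M‖) * ‖N‖ := by
  have h1 : ‖S.Bᵀ * N‖ ≤ ‖S.B‖ * ‖N‖ := by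
    simpa using frobenius_norm_mul S.Bᵀ N
  have h2 : ‖S.Dᵀ * N * M‖ ≤ ‖S.D‖ * ‖N‖ * ‖M‖ := by
    refine (frobenius_norm_mul _ _).trans (mul_le_mul_of_nonneg_right ?_ (norm_nonneg _))
    simpa using frobenius_norm_mul S.Dᵀ N
  calc _ ≤ ‖S.Bᵀ * N‖ + ‖S.Dᵀ * N * M‖ := norm_add_le _ _
    _ ≤ ‖S.B‖ * ‖N‖ + ‖S.D‖ * ‖N‖ * ‖M‖ := add_le_add h1 h2
    _ = _ := by ring

/-- Near the stabilizing solution the error of an outer solution is quadratic in the error of the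
disturbance gain. -/
theorem exists_quadratic_estimate (hR : S.Rᵀ = S.R) (hγ : 0 < S.γ)
    {Pstar : Matrix (Fin n) (Fin n) ℝ} (hstar : S.IsOuterSolution (S.gainL Pstar) Pstar) :
    ∃ ρ C : ℝ, 0 < ρ ∧ 0 < C ∧ ∀ L P, S.IsOuterSolution L P → ‖Pstar - P‖ < ρ →
      ‖L - S.gainL Pstar‖ < ρ → ‖Pstar - P‖ ≤ C * ‖L - S.gainL Pstar‖ ^ 2 := by
  obtain ⟨hs, hsR, hsr, hst⟩ := isOuterSolution_iff.1 hstar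
  obtain ⟨M, hM, hMle⟩ := hst.exists_norm_le
  have hinv := (tendsto_weight_inv hsR tendsto_id).norm.eventually_lt_const
    (lt_add_one ‖(S.R + S.Dᵀ * Pstar * S.D)⁻¹‖)
  obtain ⟨ρ₁, hρ₁, hball⟩ := Metric.eventually_nhds_iff.1 hinv
  set r := ‖(S.R + S.Dᵀ * Pstar * S.D)⁻¹‖ + 1 with hr
  set b := ‖S.B‖ + ‖S.D‖ * ‖S.C - S.D * S.gainK Pstar‖ with hb
  set g := ‖S.G‖ / S.γ ^ 2 with hg
  have hr0 : 0 < r := by positivity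
  have hb0 : 0 ≤ b := by positivity
  have hg0 : 0 ≤ g := by positivity
  -- The first entry bounds the inverse weight by `r`. The second makes every term containing `X` at
  -- most `‖X‖ / 2` after multiplication by `M`, so that it is absorbed on the left.
  set ρ := min ρ₁ (1 / (2 * M * (2 * S.γ ^ 2 * g + b ^ 2 * r) + 1)) with hρ
  have hρ0 : 0 < ρ := lt_min hρ₁ (by positivity)
  have hρM : M * (2 * S.γ ^ 2 * g + b ^ 2 * r) * ρ ≤ 1 / 2 := by
    have h1 : ρ ≤ 1 / (2 * M * (2 * S.γ ^ 2 * g + b ^ 2 * r) + 1) := min_le_right _ _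
    rw [le_div_iff₀ (by positivity)] at h1
    nlinarith
  refine ⟨ρ, 2 * M * S.γ ^ 2, hρ0, by positivity, fun L P hP hPρ hLρ => ?_⟩
  obtain ⟨hPs, hPR, hPr, -⟩ := isOuterSolution_iff.1 hP
  set X := Pstar - P with hX
  set Δ := L - S.gainL Pstar with hΔ
  have hXs : Xᵀ = X := by simp [hX, hs, hPs]
  have hPX : P - Pstar = -X := by rw [hX, neg_sub]
  have hinvP : ‖(S.R + S.Dᵀ * P * S.D)⁻¹‖ ≤ r := by
    refine (hball (y := P) ?_).le
    rw [dist_eq_norm, hPX, norm_neg]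
    exact hPρ.trans_le (min_le_left _ _)
  set U := S.Bᵀ * (P - Pstar) + S.Dᵀ * (P - Pstar) * (S.C - S.D * S.gainK Pstar) with hU
  have hUle : ‖U‖ ≤ b * ‖X‖ := by
    have := norm_gain_increment_le S (P - Pstar) (S.C - S.D * S.gainK Pstar)
    rwa [hPX, norm_neg, ← hPX] at this
  -- The Lyapunov image of the error is purely quadratic in `X` and `Δ`: the first-order terms
  -- vanish by both completions of squares at `Pstar`.
  have key : lyap (S.drift (S.gainK Pstar) (S.gainL Pstar)) (S.diffusion (S.gainK Pstar)) X =
      -(Uᵀ * (S.R + S.Dᵀ * P * S.D)⁻¹ * U) -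
        S.γ ^ 2 • (Δᵀ * Δ + Δᵀ * S.gainL X + (S.gainL X)ᵀ * Δ) := by
    have hLP : L - S.gainL P = Δ + S.gainL X := by
      rw [hX, ← gainL_sub, hΔ]
      abel
    have e1 : S.residual (S.gainK Pstar) (S.gainL Pstar) P =
        S.residual (S.gainK Pstar) L P + S.γ ^ 2 • ((L - S.gainL P)ᵀ * (L - S.gainL P)) -
          S.γ ^ 2 • ((S.gainL X)ᵀ * S.gainL X) := by
      rw [residual_eq_gainL_sub hγ hPs _ (S.gainL Pstar), residual_eq_gainL_sub hγ hPs _ L,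
        gainL_sub, sub_add_cancel]
    rw [← residual_sub, hsr, e1, residual_eq_gainK_add hR hPs hPR, hPr,
      gainK_sub_quad hR hPs hsR hPR, ← hU, hLP]
    simp only [transpose_add, Matrix.mul_add, Matrix.add_mul, smul_add]
    abel
  have hn : ‖lyap (S.drift (S.gainK Pstar) (S.gainL Pstar)) (S.diffusion (S.gainK Pstar)) X‖ ≤
      b ^ 2 * r * ‖X‖ ^ 2 + S.γ ^ 2 * (‖Δ‖ ^ 2 + 2 * g * ‖Δ‖ * ‖X‖) := by
    have n1 : ‖Uᵀ * (S.R + S.Dᵀ * P * S.D)⁻¹ * U‖ ≤ b ^ 2 * r * ‖X‖ ^ 2 := by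
      calc _ ≤ ‖Uᵀ * (S.R + S.Dᵀ * P * S.D)⁻¹‖ * ‖U‖ := frobenius_norm_mul _ _
        _ ≤ ‖Uᵀ‖ * ‖(S.R + S.Dᵀ * P * S.D)⁻¹‖ * ‖U‖ := by
          gcongr
          exact frobenius_norm_mul _ _
        _ ≤ (b * ‖X‖) * r * (b * ‖X‖) := by
          rw [frobenius_norm_transpose]
          gcongr
        _ = _ := by ring
    have n2 : ‖Δᵀ * Δ‖ ≤ ‖Δ‖ ^ 2 := by
      simpa [sq] using frobenius_norm_mul Δᵀ Δ
    have n3 : ‖Δᵀ * S.gainL X‖ ≤ g * ‖Δ‖ * ‖X‖ := by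
      calc _ ≤ ‖Δᵀ‖ * ‖S.gainL X‖ := frobenius_norm_mul _ _
        _ ≤ ‖Δ‖ * (g * ‖X‖) := by
          rw [frobenius_norm_transpose]
          gcongr
          exact norm_gainL_le S X
        _ = _ := by ring
    have n4 : ‖(S.gainL X)ᵀ * Δ‖ ≤ g * ‖Δ‖ * ‖X‖ := by
      rw [← frobenius_norm_transpose, transpose_mul, transpose_transpose]
      exact n3
    rw [key]
    calc _ ≤ ‖-(Uᵀ * (S.R + S.Dᵀ * P * S.D)⁻¹ * U)‖ +
          ‖S.γ ^ 2 • (Δᵀ * Δ + Δᵀ * S.gainL X + (S.gainL X)ᵀ * Δ)‖ := norm_sub_le _ _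
      _ ≤ b ^ 2 * r * ‖X‖ ^ 2 + S.γ ^ 2 * ‖Δᵀ * Δ + Δᵀ * S.gainL X + (S.gainL X)ᵀ * Δ‖ := by
        rw [norm_neg, norm_smul, Real.norm_of_nonneg (by positivity : 0 ≤ S.γ ^ 2)]
        gcongr
      _ ≤ _ := by
        gcongr
        refine (norm_add₃_le).trans ?_
        linarith
  have hfin := hMle X hXs
  have hX0 := norm_nonneg X
  have hΔ0 := norm_nonneg Δ
  have h1 : M * ‖lyap (S.drift (S.gainK Pstar) (S.gainL Pstar)) (S.diffusion (S.gainK Pstar)) X‖ ≤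
      M * (b ^ 2 * r * (ρ * ‖X‖) + S.γ ^ 2 * (‖Δ‖ ^ 2 + 2 * g * (ρ * ‖X‖))) := by
    gcongr
    refine hn.trans ?_
    have h2 : ‖X‖ ^ 2 ≤ ρ * ‖X‖ := by
      rw [sq]
      gcongr
    have h3 : 2 * g * ‖Δ‖ * ‖X‖ ≤ 2 * g * (ρ * ‖X‖) := by
      rw [mul_assoc]
      gcongr
    gcongr
  have h2 := mul_le_mul_of_nonneg_right hρM hX0
  nlinarith

/-- One inexact step near the stabilizing solution contracts up to a quadratic error. -/
theorem exists_local_contraction (hQ : S.Qᵀ = S.Q) (hR : S.Rᵀ = S.R) (hγ : 0 < S.γ)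
    {Pstar : Matrix (Fin n) (Fin n) ℝ} (hstar : S.IsOuterSolution (S.gainL Pstar) Pstar) :
    ∃ ρ ε C : ℝ, 0 < ρ ∧ 0 < ε ∧ 0 < C ∧ ∀ P δ, ‖Pstar - P‖ < ρ → ‖δ‖ < ε →
      ∃ P', S.IsOuterSolution (S.gainL P + δ) P' ∧ ‖Pstar - P'‖ < ρ ∧
        ‖Pstar - P'‖ ≤ 1 / 2 * ‖Pstar - P‖ + C * ‖δ‖ ^ 2 := by
  obtain ⟨ρ₀, C₀, hρ₀, hC₀, hquad⟩ := exists_quadratic_estimate hR hγ hstar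
  obtain ⟨ε₀, hε₀, hnear⟩ := hstar.exists_near hQ hR hρ₀
  set g := ‖S.G‖ / S.γ ^ 2 with hg
  have hg0 : 0 ≤ g := by positivity
  set m := min ε₀ ρ₀ with hm
  have hm0 : 0 < m := lt_min hε₀ hρ₀
  -- The first entry leaves half of the gain tolerance `m` to the disturbance; the second turns the
  -- quadratic term into the factor `1/2`.
  set ρ := min (m / (2 * (g + 1))) (1 / (4 * C₀ * (g ^ 2 + 1))) with hρ
  have hρ0 : 0 < ρ := lt_min (by positivity) (by positivity)
  have hρ1 : g * ρ ≤ m / 2 := by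
    have h1 : ρ ≤ m / (2 * (g + 1)) := min_le_left _ _
    rw [le_div_iff₀ (by positivity)] at h1
    nlinarith
  have hρ2 : 2 * C₀ * g ^ 2 * ρ ≤ 1 / 2 := by
    have h1 : ρ ≤ 1 / (4 * C₀ * (g ^ 2 + 1)) := min_le_right _ _
    rw [le_div_iff₀ (by positivity)] at h1
    nlinarith [mul_pos hC₀ hρ0]
  -- The last two entries give `2 C₀ ε² ≤ ρ / 2`, which makes the ball of radius `ρ` invariant.
  set ε := min (m / 2) (min 1 (ρ / (4 * C₀))) with hε
  have hε0 : 0 < ε := lt_min (by positivity) (lt_min one_pos (by positivity))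
  have hε2 : 2 * C₀ * ε ^ 2 ≤ ρ / 2 := by
    have h1 : ε ≤ 1 := (min_le_right _ _).trans (min_le_left _ _)
    have h2 : ε ≤ ρ / (4 * C₀) := (min_le_right _ _).trans (min_le_right _ _)
    rw [le_div_iff₀ (by positivity)] at h2
    nlinarith [mul_pos hC₀ hε0]
  refine ⟨ρ, ε, 2 * C₀, hρ0, hε0, by positivity, fun P δ hP hδ => ?_⟩
  have hL : ‖S.gainL P + δ - S.gainL Pstar‖ ≤ ‖δ‖ + g * ‖Pstar - P‖ := by
    have h1 : S.gainL P + δ - S.gainL Pstar = δ - S.gainL (Pstar - P) := by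
      rw [← gainL_sub]
      abel
    rw [h1]
    exact (norm_sub_le _ _).trans (by gcongr; exact norm_gainL_le S _)
  have hLm : ‖S.gainL P + δ - S.gainL Pstar‖ < m := by
    have h1 : ε ≤ m / 2 := min_le_left _ _
    have h2 : g * ‖Pstar - P‖ ≤ g * ρ := by gcongr
    linarith
  obtain ⟨P', hP', hP'n⟩ := hnear _ (hLm.trans_le (min_le_left _ _))
  have hq := hquad _ P' hP' (by rwa [norm_sub_rev]) (hLm.trans_le (min_le_right _ _))
  have hx0 := norm_nonneg (Pstar - P)
  have hd0 := norm_nonneg δ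
  have hfin : ‖Pstar - P'‖ ≤ 1 / 2 * ‖Pstar - P‖ + 2 * C₀ * ‖δ‖ ^ 2 := by
    refine hq.trans ?_
    have h1 : ‖S.gainL P + δ - S.gainL Pstar‖ ^ 2 ≤ 2 * ‖δ‖ ^ 2 + 2 * (g * ‖Pstar - P‖) ^ 2 := by
      calc _ ≤ (‖δ‖ + g * ‖Pstar - P‖) ^ 2 := by gcongr
        _ ≤ _ := by nlinarith [sq_nonneg (‖δ‖ - g * ‖Pstar - P‖)]
    have h2 : 2 * C₀ * g ^ 2 * ‖Pstar - P‖ * ‖Pstar - P‖ ≤ 1 / 2 * ‖Pstar - P‖ := by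
      gcongr
      refine le_trans ?_ hρ2
      gcongr
    calc _ ≤ C₀ * (2 * ‖δ‖ ^ 2 + 2 * (g * ‖Pstar - P‖) ^ 2) := by gcongr
      _ = 2 * C₀ * g ^ 2 * ‖Pstar - P‖ * ‖Pstar - P‖ + 2 * C₀ * ‖δ‖ ^ 2 := by ring
      _ ≤ _ := by linarith
  refine ⟨P', hP', lt_of_le_of_lt hfin ?_, hfin⟩
  have h1 : 2 * C₀ * ‖δ‖ ^ 2 ≤ 2 * C₀ * ε ^ 2 := by gcongr
  linarith

open Classical in
/-- The stabilizing solution for a fixed disturbance gain, if there is one. -/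
noncomputable def outerSolution (S : RobustLQ n m₁ m₂) (L : Matrix (Fin m₂) (Fin n) ℝ) :
    Matrix (Fin n) (Fin n) ℝ :=
  if h : ∃ P, S.IsOuterSolution L P then h.choose else 0

theorem IsOuterSolution.outerSolution_eq (hR : S.Rᵀ = S.R) (h : S.IsOuterSolution L P) :
    S.outerSolution L = P := by
  have hex : ∃ P, S.IsOuterSolution L P := ⟨P, h⟩
  rw [outerSolution, dif_pos hex]
  exact hex.choose_spec.unique hR h

/-- The disturbance gains of the inexact outer loop. -/
noncomputable def inexactGain (S : RobustLQ n m₁ m₂) (δ : ℕ → Matrix (Fin m₂) (Fin n) ℝ) :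
    ℕ → Matrix (Fin m₂) (Fin n) ℝ
  | 0 => 0
  | k + 1 => S.gainL (S.outerSolution (S.inexactGain δ k)) + δ (k + 1)

/-- The iterates of the inexact outer loop, with an arbitrary value at `0`. -/
noncomputable def inexactIterate (S : RobustLQ n m₁ m₂) (δ : ℕ → Matrix (Fin m₂) (Fin n) ℝ) (k : ℕ) :
    Matrix (Fin n) (Fin n) ℝ :=
  S.outerSolution (S.inexactGain δ (k - 1))

theorem isInexactOuterLoop_inexactIterate {δ : ℕ → Matrix (Fin m₂) (Fin n) ℝ}
    (h : ∀ k, S.IsOuterSolution (S.inexactGain δ k) (S.inexactIterate δ (k + 1))) :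
    S.IsInexactOuterLoop δ (S.inexactIterate δ) (S.inexactGain δ) := by
  refine ⟨rfl, h, fun k hk => ?_⟩
  obtain ⟨j, rfl⟩ := Nat.exists_eq_add_of_le' hk
  rfl

theorem IsInexactOuterLoop.unique (hR : S.Rᵀ = S.R) {δ : ℕ → Matrix (Fin m₂) (Fin n) ℝ}
    {P P' : ℕ → Matrix (Fin n) (Fin n) ℝ} {L L' : ℕ → Matrix (Fin m₂) (Fin n) ℝ}
    (h : S.IsInexactOuterLoop δ P L) (h' : S.IsInexactOuterLoop δ P' L') (k : ℕ) :
    P' (k + 1) = P (k + 1) ∧ L' k = L k := by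
  have key : ∀ k, L' k = L k → P' (k + 1) = P (k + 1) := fun k hk => by
    have h1 := h'.2.1 k
    rw [hk] at h1
    exact h1.unique hR (h.2.1 k)
  have hL : ∀ k, L' k = L k := by
    intro k
    induction k with
    | zero => rw [h.1, h'.1]
    | succ k ih => rw [h.2.2 _ k.succ_pos, h'.2.2 _ k.succ_pos, key k ih]
  exact ⟨key k (hL k), hL k⟩

/-- For small disturbances finitely many steps of the inexact outer loop stay close to the exact
ones. -/
theorem exists_inexactIterate_near (hQ : S.Qᵀ = S.Q) (hR : S.Rᵀ = S.R)
    {P : ℕ → Matrix (Fin n) (Fin n) ℝ} (h0 : P 0 = 0)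
    (hP : ∀ k, S.IsOuterSolution (S.gainL (P k)) (P (k + 1))) (k : ℕ) :
    ∀ η : ℝ, 0 < η → ∃ ε : ℝ, 0 < ε ∧ ∀ δ : ℕ → Matrix (Fin m₂) (Fin n) ℝ,
      (∀ j, ‖δ (j + 1)‖ < ε) → S.IsOuterSolution (S.inexactGain δ k) (S.inexactIterate δ (k + 1)) ∧
        ‖S.inexactIterate δ (k + 1) - P (k + 1)‖ < η := by
  induction k with
  | zero =>
    intro η hη
    -- The first iterate belongs to the gain `0` and is exact, so any threshold serves.
    refine ⟨1, one_pos, fun δ _ => ?_⟩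
    have h1 := hP 0
    rw [h0, gainL_zero] at h1
    have h2 : S.inexactIterate δ (0 + 1) = P (0 + 1) := h1.outerSolution_eq hR
    rw [h2, sub_self, norm_zero]
    exact ⟨h1, hη⟩
  | succ k ih =>
    intro η hη
    obtain ⟨ε₁, hε₁, hnear⟩ := (hP (k + 1)).exists_near hQ hR hη
    set g := ‖S.G‖ / S.γ ^ 2 with hg
    have hg0 : 0 ≤ g := by positivity
    obtain ⟨ε₂, hε₂, h2⟩ := ih (ε₁ / (2 * (g + 1))) (by positivity)
    refine ⟨min ε₂ (ε₁ / 2), lt_min hε₂ (by positivity), fun δ hδ => ?_⟩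
    obtain ⟨-, h3⟩ := h2 δ fun j => (hδ j).trans_le (min_le_left _ _)
    have h4 : S.inexactGain δ (k + 1) = S.gainL (S.inexactIterate δ (k + 1)) + δ (k + 1) := rfl
    have h5 : ‖S.inexactGain δ (k + 1) - S.gainL (P (k + 1))‖ < ε₁ := by
      rw [h4, add_sub_right_comm, gainL_sub]
      have h6 := norm_gainL_le S (S.inexactIterate δ (k + 1) - P (k + 1))
      have h7 := (hδ k).trans_le (min_le_right _ _)
      rw [lt_div_iff₀ (by positivity)] at h3
      have h8 := norm_nonneg (S.inexactIterate δ (k + 1) - P (k + 1))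
      refine (norm_add_le _ _).trans_lt ?_
      nlinarith
    obtain ⟨P', hP', hn⟩ := hnear _ h5
    have h6 : S.inexactIterate δ (k + 1 + 1) = P' := hP'.outerSolution_eq hR
    rw [h6]
    exact ⟨hP', hn⟩

theorem exists_pos_forall_le {α : Type*} {p : α → ℕ → Prop} {f : α → ℕ → ℝ}
    (h : ∀ k, ∃ ε : ℝ, 0 < ε ∧ ∀ a, (∀ j, f a j < ε) → p a k) (N : ℕ) :
    ∃ ε : ℝ, 0 < ε ∧ ∀ a, (∀ j, f a j < ε) → ∀ k ≤ N, p a k := by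
  induction N with
  | zero =>
    obtain ⟨ε, hε, hp⟩ := h 0
    exact ⟨ε, hε, fun a ha k hk => Nat.le_zero.1 hk ▸ hp a ha⟩
  | succ N ih =>
    obtain ⟨ε₁, hε₁, h1⟩ := ih
    obtain ⟨ε₂, hε₂, h2⟩ := h (N + 1)
    refine ⟨min ε₁ ε₂, lt_min hε₁ hε₂, fun a ha k hk => ?_⟩
    rcases Nat.lt_or_ge N k with hk' | hk'
    · obtain rfl : k = N + 1 := by omega
      exact h2 a fun j => (ha j).trans_le (min_le_right _ _)
    · exact h1 a (fun j => (ha j).trans_le (min_le_left _ _)) k hk'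

/-- Input-to-state stability of the inexact outer loop. -/
theorem exists_inexact_estimate (hQ : S.Q.PosSemidef) (hR : S.R.PosDef) (hγ : 0 < S.γ)
    (hdet : S.ExactlyDetectable) {Pstar : Matrix (Fin n) (Fin n) ℝ}
    (hstar : S.IsStabilizingSARE Pstar) :
    ∃ ε α c : ℝ, 0 < ε ∧ 0 < α ∧ α < 1 ∧ 0 < c ∧ ∀ (δ : ℕ → Matrix (Fin m₂) (Fin n) ℝ) (s : ℝ),
      (∀ j, ‖δ (j + 1)‖ ≤ s) → s < ε →
      S.IsInexactOuterLoop δ (S.inexactIterate δ) (S.inexactGain δ) ∧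
      ∀ k, ‖Pstar - S.inexactIterate δ (k + 1)‖ ≤
        α ^ k * ‖Pstar - S.inexactIterate δ 1‖ + c * s ^ 2 := by
  obtain ⟨hp, hout⟩ := (isStabilizingSARE_iff hR hγ).1 hstar
  have hQs := hQ.transpose_eq
  have hRs := hR.transpose_eq
  obtain ⟨P, h0, hP, hmono, hle⟩ := exists_exact_iteration hQ hR hγ hdet hp hout
  have hlim := tendsto_exact_iteration hQ hR hγ hout h0 hP hmono hle
  obtain ⟨ρ, ε₀, C, hρ, hε₀, hC, hloc⟩ := exists_local_contraction hQs hRs hγ hout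
  have hfirst : ∀ δ, S.inexactIterate δ 1 = P 1 := fun δ => by
    have h1 := hP 0
    rw [h0, gainL_zero] at h1
    exact h1.outerSolution_eq hRs
  set r := ‖Pstar - P 1‖ with hr
  have hr0 : 0 ≤ r := norm_nonneg _
  -- `N` is a time of entry into the ball. The strict bounds for `1 ≤ k ≤ N` are finitely many and
  -- hold at `α = 1`, hence also for some `α < 1`; `α ≥ 1/2` makes it compatible with the local
  -- contraction.
  obtain ⟨N, α, hα, hα1, hN, hdec⟩ : ∃ (N : ℕ) (α : ℝ), 1 / 2 ≤ α ∧ α < 1 ∧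
      ‖Pstar - P (N + 1)‖ < ρ ∧ ∀ k, 1 ≤ k → k ≤ N → ‖Pstar - P (k + 1)‖ < α ^ k * r := by
    by_cases hne : P 1 = Pstar
    · refine ⟨0, 1 / 2, le_rfl, by norm_num, ?_, fun k h1 h2 => by omega⟩
      rw [zero_add, hne, sub_self, norm_zero]
      exact hρ
    · have hev := (hlim.comp (tendsto_add_atTop_nat 1)).eventually (Metric.ball_mem_nhds Pstar hρ)
      obtain ⟨N, hN⟩ := hev.exists
      have hα : ∀ᶠ α in 𝓝[<] (1 : ℝ), ∀ k ∈ Finset.Icc 1 N, ‖Pstar - P (k + 1)‖ < α ^ k * r := by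
        refine (Finset.eventually_all _).2 fun k hk => ?_
        have hlt := exact_iteration_norm_lt hRs hP hmono hle hlim hne (Finset.mem_Icc.1 hk).1
        have ht : Tendsto (fun α : ℝ => α ^ k * r) (𝓝[<] 1) (𝓝 r) := by
          have : Continuous fun α : ℝ => α ^ k * r := by fun_prop
          simpa using (this.tendsto 1).mono_left nhdsWithin_le_nhds
        exact ht.eventually_const_lt hlt
      obtain ⟨α, h1, h2⟩ := (hα.and (Ioo_mem_nhdsLT (show (1 / 2 : ℝ) < 1 by norm_num))).exists
      refine ⟨N, α, h2.1.le, h2.2, ?_, fun k hk1 hkN => h1 k (Finset.mem_Icc.2 ⟨hk1, hkN⟩)⟩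
      simpa [dist_eq_norm, norm_sub_rev] using hN
  have hα0 : 0 < α := by linarith
  -- Up to step `N` the slack in the strict inequalities absorbs the disturbance entirely, so no
  -- term in `s` appears. For `k = 0` there is no slack, but the bound is an equality.
  have hfinite : ∀ k, ∃ ε : ℝ, 0 < ε ∧ ∀ δ : ℕ → Matrix (Fin m₂) (Fin n) ℝ,
      (∀ j, ‖δ (j + 1)‖ < ε) → S.IsOuterSolution (S.inexactGain δ k) (S.inexactIterate δ (k + 1)) ∧
        (k ≤ N → ‖Pstar - S.inexactIterate δ (k + 1)‖ ≤ α ^ k * r) ∧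
        (k = N → ‖Pstar - S.inexactIterate δ (k + 1)‖ < ρ) := by
    intro k
    have htri : ∀ Z : Matrix (Fin n) (Fin n) ℝ,
        ‖Pstar - Z‖ ≤ ‖Pstar - P (k + 1)‖ + ‖Z - P (k + 1)‖ := fun Z => by
      rw [norm_sub_rev Z]
      exact norm_sub_le_norm_sub_add_norm_sub _ _ _
    obtain ⟨η₁, hη₁, hη₁'⟩ : ∃ η : ℝ, 0 < η ∧ (k = N → ‖Pstar - P (k + 1)‖ + η ≤ ρ) := by
      by_cases hk : k = N
      · subst hk
        exact ⟨ρ - ‖Pstar - P (k + 1)‖, by linarith, fun _ => by linarith⟩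
      · exact ⟨1, one_pos, fun h => (hk h).elim⟩
    obtain ⟨η₂, hη₂, hη₂'⟩ : ∃ η : ℝ, 0 < η ∧
        (1 ≤ k → k ≤ N → ‖Pstar - P (k + 1)‖ + η ≤ α ^ k * r) := by
      by_cases hk : 1 ≤ k ∧ k ≤ N
      · have := hdec k hk.1 hk.2
        exact ⟨α ^ k * r - ‖Pstar - P (k + 1)‖, by linarith, fun _ _ => by linarith⟩
      · exact ⟨1, one_pos, fun h h' => (hk ⟨h, h'⟩).elim⟩
    obtain ⟨ε, hε, h⟩ := exists_inexactIterate_near hQs hRs h0 hP k (min η₁ η₂)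
      (lt_min hη₁ hη₂)
    refine ⟨ε, hε, fun δ hδ => ?_⟩
    obtain ⟨h1, h2⟩ := h δ hδ
    have h3 := htri (S.inexactIterate δ (k + 1))
    refine ⟨h1, fun hk => ?_, fun hk => ?_⟩
    · rcases Nat.eq_zero_or_pos k with rfl | hk0
      · rw [zero_add, hfirst, pow_zero, one_mul]
      · linarith [hη₂' hk0 hk, h2.trans_le (min_le_right _ _)]
    · linarith [hη₁' hk, h2.trans_le (min_le_left _ _)]
  obtain ⟨ε₁, hε₁, hfin⟩ := exists_pos_forall_le
    (f := fun (δ : ℕ → Matrix (Fin m₂) (Fin n) ℝ) j => ‖δ (j + 1)‖) hfinite N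
  refine ⟨min ε₀ ε₁, α, 2 * C, lt_min hε₀ hε₁, hα0, hα1, by positivity, fun δ s hδ hs => ?_⟩
  have hf := hfin δ fun j => (hδ j).trans_lt (hs.trans_le (min_le_right _ _))
  have hCs : 0 ≤ C * s ^ 2 := by positivity
  -- The offset `2 C s²` is the fixed point of `x ↦ x / 2 + C s²`, so the induction reproduces it.
  have htail : ∀ j, S.IsOuterSolution (S.inexactGain δ (N + j)) (S.inexactIterate δ (N + j + 1)) ∧
      ‖Pstar - S.inexactIterate δ (N + j + 1)‖ < ρ ∧
      ‖Pstar - S.inexactIterate δ (N + j + 1)‖ ≤ α ^ (N + j) * r + 2 * (C * s ^ 2) := by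
    intro j
    induction j with
    | zero =>
      obtain ⟨h1, h2, h3⟩ := hf N le_rfl
      exact ⟨h1, h3 rfl, by rw [add_zero]; linarith [h2 le_rfl]⟩
    | succ j ih =>
      obtain ⟨h1, h2, h3⟩ := ih
      obtain ⟨P', hP', hρ', hest⟩ := hloc _ (δ (N + j + 1)) h2
        ((hδ _).trans_lt (hs.trans_le (min_le_left _ _)))
      have h4 : S.inexactIterate δ (N + (j + 1) + 1) = P' := hP'.outerSolution_eq hRs
      rw [h4]
      refine ⟨hP', hρ', hest.trans ?_⟩
      have h5 : ‖δ (N + j + 1)‖ ^ 2 ≤ s ^ 2 := by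
        gcongr
        exact hδ _
      have h6 := mul_le_mul_of_nonneg_left h5 hC.le
      have h7 : 0 ≤ α ^ (N + j) * r := by positivity
      have h8 : 1 / 2 * (α ^ (N + j) * r) ≤ α ^ (N + (j + 1)) * r := by
        rw [← add_assoc, pow_succ α (N + j)]
        nlinarith
      linarith
  have hall : ∀ k, S.IsOuterSolution (S.inexactGain δ k) (S.inexactIterate δ (k + 1)) ∧
      ‖Pstar - S.inexactIterate δ (k + 1)‖ ≤ α ^ k * r + 2 * (C * s ^ 2) := by
    intro k
    rcases le_total k N with hk | hk
    · obtain ⟨h1, h2, -⟩ := hf k hk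
      exact ⟨h1, by linarith [h2 hk]⟩
    · obtain ⟨j, rfl⟩ := Nat.exists_eq_add_of_le hk
      exact ⟨(htail j).1, (htail j).2.2⟩
  refine ⟨isInexactOuterLoop_inexactIterate fun k => (hall k).1, fun k => ?_⟩
  rw [hfirst, mul_assoc 2]
  exact (hall k).2

end RobustLQ

end InexactIteration

/-! ### Comparison functions and the main theorem. -/

theorem isClassKL_rpow_mul {α b : ℝ} (hα : 0 < α) (hα1 : α < 1) (hb : 0 < b) :
    IsClassKL fun r t => α ^ t * b * r := by
  have hc : Continuous fun t : ℝ => α ^ t := Real.continuous_const_rpow hα.ne'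
  refine ⟨?_, fun t _ => ⟨by simp, by fun_prop, fun x _ y _ hxy => ?_⟩, fun r hr => ⟨?_, ?_⟩⟩
  · exact (((hc.comp continuous_snd).mul continuous_const).mul continuous_fst).continuousOn
  · have : 0 < α ^ t * b := mul_pos (Real.rpow_pos_of_pos hα t) hb
    exact mul_lt_mul_of_pos_left hxy this
  · intro x _ y _ hxy
    have := Real.rpow_le_rpow_of_exponent_ge hα hα1.le hxy
    have hr' : 0 ≤ r := hr
    change α ^ y * b * r ≤ α ^ x * b * r
    gcongr
  · have := ((tendsto_rpow_atTop_of_base_lt_one α (by linarith) hα1).mul_const b).mul_const r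
    simpa using this

theorem isClassK_mul_sq {c : ℝ} (hc : 0 < c) : IsClassK fun s => c * s ^ 2 := by
  refine ⟨by simp, by fun_prop, fun x hx y _ hxy => ?_⟩
  have hx' : 0 ≤ x := hx
  exact mul_lt_mul_of_pos_left (pow_lt_pow_left₀ hxy hx' two_ne_zero) hc

theorem theorem5 {n m₁ m₂ : ℕ} (hn : 1 ≤ n) (S : RobustLQ n m₁ m₂)
    (hQ : S.Q.PosSemidef) (hR : S.R.PosDef) (hγ : 0 < S.γ)
    (hstab : S.Stabilizable) (hdet : S.ExactlyDetectable)
    (Pstar : Matrix (Fin n) (Fin n) ℝ) (hPstar : S.IsStabilizingSARE Pstar) :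
    ∀ ζ : ℝ, Pstar.trace ≤ ζ →
      ∃ ε : ℝ, 0 < ε ∧ ∃ (ℓ : ℝ → ℝ → ℝ) (κ : ℝ → ℝ), IsClassKL ℓ ∧ IsClassK κ ∧
        (∃ α : ℝ, 0 < α ∧ α < 1 ∧ ∀ (r : ℝ) (k : ℕ), 0 ≤ r → ℓ r k = α ^ k * √(n : ℝ) * r) ∧
        (∃ c : ℝ, 0 < c ∧ ∀ s : ℝ, 0 ≤ s → κ s = c * s ^ 2) ∧
        ∀ δL : ℕ → Matrix (Fin m₂) (Fin n) ℝ,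
          BddAbove (Set.range fun k : ℕ => ‖δL (k + 1)‖) → supFrob δL < ε →
          ∃ (P : ℕ → Matrix (Fin n) (Fin n) ℝ) (L : ℕ → Matrix (Fin m₂) (Fin n) ℝ),
            S.IsInexactOuterLoop δL P L ∧
            (∀ P' L', S.IsInexactOuterLoop δL P' L' →
              ∀ k, P' (k + 1) = P (k + 1) ∧ L' k = L k) ∧
            ∀ k : ℕ, 1 ≤ k →
              ‖Pstar - P (k + 1)‖ ≤ ℓ ‖Pstar - P 1‖ k + κ (supFrob δL) := by
  intro ζ _
  obtain ⟨ε, α, c, hε, hα, hα1, hc, hest⟩ :=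
    RobustLQ.exists_inexact_estimate hQ hR hγ hdet hPstar
  have hn' : (1 : ℝ) ≤ √(n : ℝ) := Real.one_le_sqrt.2 (by exact_mod_cast hn)
  refine ⟨ε, hε, fun r t => α ^ t * √(n : ℝ) * r, fun s => c * s ^ 2,
    isClassKL_rpow_mul hα hα1 (by linarith), isClassK_mul_sq hc,
    ⟨α, hα, hα1, fun r k _ => by simp only [Real.rpow_natCast]⟩, ⟨c, hc, fun s _ => rfl⟩,
    fun δL hbdd hsup => ?_⟩
  obtain ⟨hloop, hbound⟩ := hest δL (supFrob δL) (fun j => le_ciSup hbdd j) hsup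
  refine ⟨_, _, hloop, fun P' L' h' k => hloop.unique hR.transpose_eq h' k, fun k _ => ?_⟩
  refine (hbound k).trans ?_
  simp only [Real.rpow_natCast]
  -- The estimate holds without `√n`; as `n ≥ 1`, the factor only enlarges the bound.
  gcongr
  exact le_mul_of_one_le_right (by positivity) hn'
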